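/- Let $N\ge 1$ be an integer. A modular function of level $N$ is a meromorphic function $f$ on the upper half-plane $\mathbb H$ such that $f(\gamma\tau)=f(\tau)$ for all $\gamma\in\Gamma(N)$ and such that $f$ is meromorphic at all cusps, i.e. for every $\gamma\in SL_2(\mathbb Z)$ the function $\tau\mapsto f(\gamma\tau)$ is, for $\operatorname{Im}\tau$ large, of the form $F(e^{2\pi i\tau/N})$ with $F$ meromorphic in a neighbourhood of $0$. Let $F_{N,\mathbb C}$ be the field of all modular functions of level $N$, a subfield of the field of meromorphic functions on $\mathbb H$. Let $$j=\frac{E_4^3}{\Delta},\qquad \Delta=\frac{E_4^3-E_6^2}{1728},$$ where $E_4,E_6$ are the normalized Eisenstein series of weights $4$ and $6$. For $\tau\in\mathbb H$ put $L_\tau=\mathbb Z\tau\oplus\mathbb Z$, $g_2(L_\tau)=60\sum_{0\ne\omega\in L_\tau}\omega^{-4}$ and $g_3(L_\tau)=140\sum_{0\ne\omega\in L_\tau}\omega^{-6}$, and for $a=(a_1,a_2)\in\mathbb Q^2\setminus\mathbb Z^2$ let $$f_a(\tau)=\frac{g_2(L_\tau)\,g_3(L_\tau)}{g_2(L_\tau)^3-27g_3(L_\tau)^2}\;\wp_{L_\tau}(a_1\tau+a_2)$$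 be the Fricke function, where $\wp_{L_\tau}$ is the Weierstrass function of $L_\tau$. Let $$S=\left\{\left(\tfrac rN,\tfrac sN\right): r,s\in\mathbb{Z},\ 0\le r,s\le N-1,\ (r,s)\ne(0,0)\right\}.$$ Then $j$ and all $f_a$ $(a\in S)$ are meromorphic on $\mathbb H$, and $$F_{N,\mathbb C}=\mathbb C\left(\{j,f_a\mid a\in S\}\right).$$ Moreover, for $\gamma\in SL_2(\mathbb Z)$ one has $f_a(\gamma\tau)=f_a(\tau)$ for all $a\in S$ and all $\tau\in\mathbb H$ if and only if $\gamma\in\{\pm I\}\Gamma(N)$. -/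

import Mathlib

open UpperHalfPlane
open scoped MatrixGroups

noncomputable section

namespace ModularFunctions

/-! ### The field of meromorphic functions on the upper half-plane -/

/-- `f` is meromorphic on `ℍ` (the value of `f` at a pole is irrelevant). -/
def IsMeromorphic (f : ℍ → ℂ) : Prop :=
  ∀ τ : ℍ, MeromorphicAt (f ∘ ofComplex) (τ : ℂ)

/-- The `ℂ`-algebra of all functions `ℍ → ℂ` that are meromorphic on `ℍ`. -/
def meromorphicSubalgebra : Subalgebra ℂ (ℍ → ℂ) where
  carrier := {f | IsMeromorphic f}
  mul_mem' hf hg τ := (hf τ).mul (hg τ)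
  add_mem' hf hg τ := (hf τ).add (hg τ)
  algebraMap_mem' c τ := MeromorphicAt.const c (τ : ℂ)

/-- The ideal of the meromorphic functions that vanish off a closed discrete subset of `ℍ`;
two meromorphic functions that are congruent modulo it are the same meromorphic function. -/
def nullIdeal : Ideal meromorphicSubalgebra where
  carrier := {f | ∀ᶠ τ in Filter.codiscrete ℍ, (f : ℍ → ℂ) τ = 0}
  zero_mem' := by
    change ∀ᶠ τ in Filter.codiscrete ℍ, (0 : ℂ) = 0
    exact Filter.Eventually.of_forall fun _ => rfl
  add_mem' {f g} hf hg := by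
    change ∀ᶠ τ in Filter.codiscrete ℍ, (f : ℍ → ℂ) τ + (g : ℍ → ℂ) τ = 0
    filter_upwards [hf, hg] with τ h₁ h₂
    rw [h₁, h₂, add_zero]
  smul_mem' c f hf := by
    change ∀ᶠ τ in Filter.codiscrete ℍ, (c : ℍ → ℂ) τ * (f : ℍ → ℂ) τ = 0
    filter_upwards [hf] with τ h
    rw [h, mul_zero]

theorem eventually_nhdsNE_coe_iff {τ : ℍ} {p : ℂ → Prop} :
    (∀ᶠ z : ℂ in nhdsWithin (τ : ℂ) ({(τ : ℂ)}ᶜ : Set ℂ), p z) ↔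
      ∀ᶠ w : ℍ in nhdsWithin τ ({τ}ᶜ : Set ℍ), p (w : ℂ) := by
  have h : Filter.map ((↑) : ℍ → ℂ) (nhdsWithin τ {τ}ᶜ) = nhdsWithin (τ : ℂ) {(τ : ℂ)}ᶜ := by
    have h₁ : ((↑) : ℍ → ℂ) ⁻¹' {(τ : ℂ)}ᶜ = {τ}ᶜ := by
      ext w
      simp
    rw [nhdsWithin, nhdsWithin, ← isOpenEmbedding_coe.map_nhds_eq, ← h₁,
      ← Filter.comap_principal, Filter.push_pull]
  rw [← h, Filter.eventually_map]

theorem eventually_codiscrete_iff {p : ℍ → Prop} :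
    (∀ᶠ τ in Filter.codiscrete ℍ, p τ) ↔ ∀ τ : ℍ, ∀ᶠ w : ℍ in nhdsWithin τ ({τ}ᶜ : Set ℍ), p w := by
  rw [Filter.Eventually, Filter.codiscrete, mem_codiscreteWithin_iff_forall_mem_nhdsNE]
  simp [Filter.Eventually]

/-- A meromorphic function on `ℍ` vanishes off a closed discrete set, or vanishes nowhere
off a closed discrete set. -/
theorem IsMeromorphic.eventually_eq_zero_or_ne_zero {f : ℍ → ℂ} (hf : IsMeromorphic f) :
    (∀ᶠ τ in Filter.codiscrete ℍ, f τ = 0) ∨ ∀ᶠ τ in Filter.codiscrete ℍ, f τ ≠ 0 := by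
  have hU : MeromorphicOn (f ∘ ofComplex) {z : ℂ | 0 < z.im} := fun z hz => hf ⟨z, hz⟩
  have hc : IsPreconnected {z : ℂ | 0 < z.im} :=
    (convex_halfSpace_im_gt 0).isPreconnected
  by_cases h : ∃ τ : ℍ, meromorphicOrderAt (f ∘ ofComplex) (τ : ℂ) ≠ ⊤
  · right
    obtain ⟨τ₀, h₀⟩ := h
    rw [eventually_codiscrete_iff]
    intro τ
    have h₁ := hU.meromorphicOrderAt_ne_top_of_isPreconnected hc τ₀.im_pos τ.im_pos h₀
    rw [meromorphicOrderAt_ne_top_iff_eventually_ne_zero (hf τ), eventually_nhdsNE_coe_iff] at h₁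
    simpa [ofComplex_apply] using h₁
  · left
    push Not at h
    rw [eventually_codiscrete_iff]
    intro τ
    have h₁ := meromorphicOrderAt_eq_top_iff.mp (h τ)
    rw [eventually_nhdsNE_coe_iff] at h₁
    simpa [ofComplex_apply] using h₁

instance nullIdeal_isMaximal : nullIdeal.IsMaximal := by
  rw [Ideal.isMaximal_iff]
  constructor
  · intro h
    have h₁ : ∀ᶠ τ in Filter.codiscrete ℍ, (1 : ℂ) = 0 := h
    rw [eventually_codiscrete_iff] at h₁
    have h₂ := (eventually_nhdsNE_coe_iff (p := fun _ => (1 : ℂ) = 0)).mpr (h₁ UpperHalfPlane.I)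
    obtain ⟨_, h₃⟩ := h₂.exists
    exact one_ne_zero h₃
  · intro J f hJ hf hfJ
    let g : meromorphicSubalgebra := ⟨(f : ℍ → ℂ)⁻¹, fun τ => (f.2 τ).inv⟩
    have hne := (IsMeromorphic.eventually_eq_zero_or_ne_zero f.2).resolve_left hf
    have h₁ : 1 - g * f ∈ nullIdeal := by
      change ∀ᶠ τ in Filter.codiscrete ℍ, 1 - ((f : ℍ → ℂ) τ)⁻¹ * (f : ℍ → ℂ) τ = 0
      filter_upwards [hne] with τ hτ
      rw [inv_mul_cancel₀ hτ, sub_self]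
    have h₂ := J.add_mem (hJ h₁) (J.mul_mem_left g hfJ)
    rwa [sub_add_cancel] at h₂

/-- The field of meromorphic functions on `ℍ`: functions `ℍ → ℂ` that are meromorphic, taken up
to equality off a closed discrete subset of `ℍ`. -/
abbrev MeromorphicField : Type := meromorphicSubalgebra ⧸ nullIdeal

instance : Field MeromorphicField := Ideal.Quotient.field nullIdeal

/-- The element of the field of meromorphic functions that is given by `f`. -/
def toField (f : ℍ → ℂ) (hf : IsMeromorphic f) : MeromorphicField :=
  Ideal.Quotient.mk nullIdeal ⟨f, hf⟩

/-! ### Modular functions of level `N` -/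

/-- `f` is a modular function of level `N`: it is meromorphic on `ℍ`, it satisfies
`f (γ τ) = f τ` for `γ ∈ Γ(N)` (as an identity of meromorphic functions), and it is meromorphic
at every cusp `γ (i∞)`, `γ ∈ SL(2, ℤ)`: near `i∞` the function `τ ↦ f (γ τ)` is a meromorphic
function, in a neighbourhood of `0`, of the parameter `exp (2 π i τ / N)`. -/
structure IsModularFunction (N : ℕ) (f : ℍ → ℂ) : Prop where
  meromorphic : IsMeromorphic f
  invariant : ∀ γ ∈ CongruenceSubgroup.Gamma N,
    ∀ᶠ τ in Filter.codiscrete ℍ, f (γ • τ) = f τ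
  cusps : ∀ γ : SL(2, ℤ), ∃ F : ℂ → ℂ, MeromorphicAt F 0 ∧ ∃ Y : ℝ,
    ∀ᶠ τ in Filter.codiscrete ℍ,
      Y < τ.im → f (γ • τ) = F (Function.Periodic.qParam (N : ℝ) (τ : ℂ))

theorem IsModularFunction.add {N : ℕ} {f g : ℍ → ℂ} (hf : IsModularFunction N f)
    (hg : IsModularFunction N g) : IsModularFunction N (f + g) where
  meromorphic τ := (hf.meromorphic τ).add (hg.meromorphic τ)
  invariant γ hγ := by
    filter_upwards [hf.invariant γ hγ, hg.invariant γ hγ] with τ h₁ h₂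
    simp only [Pi.add_apply, h₁, h₂]
  cusps γ := by
    obtain ⟨F, hF, Y, h₁⟩ := hf.cusps γ
    obtain ⟨G, hG, Z, h₂⟩ := hg.cusps γ
    refine ⟨F + G, hF.add hG, max Y Z, ?_⟩
    filter_upwards [h₁, h₂] with τ h₁ h₂ hτ
    simp only [Pi.add_apply, h₁ ((le_max_left _ _).trans_lt hτ),
      h₂ ((le_max_right _ _).trans_lt hτ)]

theorem IsModularFunction.mul {N : ℕ} {f g : ℍ → ℂ} (hf : IsModularFunction N f)
    (hg : IsModularFunction N g) : IsModularFunction N (f * g) where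
  meromorphic τ := (hf.meromorphic τ).mul (hg.meromorphic τ)
  invariant γ hγ := by
    filter_upwards [hf.invariant γ hγ, hg.invariant γ hγ] with τ h₁ h₂
    simp only [Pi.mul_apply, h₁, h₂]
  cusps γ := by
    obtain ⟨F, hF, Y, h₁⟩ := hf.cusps γ
    obtain ⟨G, hG, Z, h₂⟩ := hg.cusps γ
    refine ⟨F * G, hF.mul hG, max Y Z, ?_⟩
    filter_upwards [h₁, h₂] with τ h₁ h₂ hτ
    simp only [Pi.mul_apply, h₁ ((le_max_left _ _).trans_lt hτ),
      h₂ ((le_max_right _ _).trans_lt hτ)]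

theorem IsModularFunction.inv {N : ℕ} {f : ℍ → ℂ} (hf : IsModularFunction N f) :
    IsModularFunction N f⁻¹ where
  meromorphic τ := (hf.meromorphic τ).inv
  invariant γ hγ := by
    filter_upwards [hf.invariant γ hγ] with τ h₁
    simp only [Pi.inv_apply, h₁]
  cusps γ := by
    obtain ⟨F, hF, Y, h₁⟩ := hf.cusps γ
    refine ⟨F⁻¹, hF.inv, Y, ?_⟩
    filter_upwards [h₁] with τ h₁ hτ
    simp only [Pi.inv_apply, h₁ hτ]

theorem isModularFunction_const (N : ℕ) (c : ℂ) : IsModularFunction N (fun _ => c) where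
  meromorphic τ := MeromorphicAt.const c (τ : ℂ)
  invariant _ _ := Filter.Eventually.of_forall fun _ => rfl
  cusps _ := ⟨fun _ => c, MeromorphicAt.const c 0, 0, Filter.Eventually.of_forall fun _ _ => rfl⟩

theorem toField_inv (f : ℍ → ℂ) (hf : IsMeromorphic f) (hf' : IsMeromorphic f⁻¹) :
    (toField f hf)⁻¹ = toField f⁻¹ hf' := by
  rcases hf.eventually_eq_zero_or_ne_zero with h | h
  · have h₁ : toField f hf = 0 := Ideal.Quotient.eq_zero_iff_mem.mpr h
    have h₂ : toField f⁻¹ hf' = 0 := Ideal.Quotient.eq_zero_iff_mem.mpr <| by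
      change ∀ᶠ τ in Filter.codiscrete ℍ, (f τ)⁻¹ = 0
      filter_upwards [h] with τ hτ
      rw [hτ, inv_zero]
    rw [h₁, h₂, inv_zero]
  · refine inv_eq_of_mul_eq_one_right ?_
    refine (Ideal.Quotient.mk_eq_mk_iff_sub_mem _ (1 : meromorphicSubalgebra)).mpr ?_
    change ∀ᶠ τ in Filter.codiscrete ℍ, f τ * (f τ)⁻¹ - 1 = 0
    filter_upwards [h] with τ hτ
    rw [mul_inv_cancel₀ hτ, sub_self]

/-- The field `F_{N,ℂ}` of all modular functions of level `N`, as a subfield (containing `ℂ`) of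
the field of meromorphic functions on `ℍ`. -/
def modularFunctionField (N : ℕ) : IntermediateField ℂ MeromorphicField where
  carrier := {x | ∃ (f : ℍ → ℂ) (hf : IsModularFunction N f), toField f hf.meromorphic = x}
  mul_mem' := by
    rintro _ _ ⟨f, hf, rfl⟩ ⟨g, hg, rfl⟩
    exact ⟨f * g, hf.mul hg, rfl⟩
  add_mem' := by
    rintro _ _ ⟨f, hf, rfl⟩ ⟨g, hg, rfl⟩
    exact ⟨f + g, hf.add hg, rfl⟩
  algebraMap_mem' c := ⟨fun _ => c, isModularFunction_const N c, rfl⟩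
  inv_mem' := by
    rintro _ ⟨f, hf, rfl⟩
    exact ⟨f⁻¹, hf.inv, (toField_inv f hf.meromorphic hf.inv.meromorphic).symm⟩

/-! ### The `j`-function and the Fricke functions -/

/-- The `j`-function `E₄³ / Δ`, where `Δ = (E₄³ - E₆²) / 1728`. -/
def jFunction (τ : ℍ) : ℂ :=
  ModularForm.E₄ τ ^ 3 / ((ModularForm.E₄ τ ^ 3 - ModularForm.E₆ τ ^ 2) / 1728)

theorem linearIndependent_coe_one (τ : ℍ) : LinearIndependent ℝ ![(τ : ℂ), 1] := by
  rw [LinearIndependent.pair_iff]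
  intro s t h
  have h₁ := congrArg Complex.im h
  have h₂ := congrArg Complex.re h
  simp only [Complex.add_im, Complex.smul_im, Complex.one_im, smul_eq_mul, mul_zero, add_zero,
    Complex.zero_im, mul_eq_zero, UpperHalfPlane.coe_im, τ.im_ne_zero, or_false] at h₁
  subst h₁
  simpa using h₂

/-- The periods `τ, 1` of the lattice `L_τ = ℤ τ ⊕ ℤ`. -/
def periodPair (τ : ℍ) : PeriodPair where
  ω₁ := τ
  ω₂ := 1
  indep := linearIndependent_coe_one τ

/-- The Fricke function
`f_a(τ) = g₂(L_τ) g₃(L_τ) / (g₂(L_τ)³ - 27 g₃(L_τ)²) * ℘_{L_τ}(a₁ τ + a₂)`. -/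
def fricke (a : ℚ × ℚ) (τ : ℍ) : ℂ :=
  (periodPair τ).g₂ * (periodPair τ).g₃ /
      ((periodPair τ).g₂ ^ 3 - 27 * (periodPair τ).g₃ ^ 2) *
    (periodPair τ).weierstrassP ((a.1 : ℂ) * (τ : ℂ) + (a.2 : ℂ))

/-- The index set `S` of all `(r / N, s / N)` with `0 ≤ r, s ≤ N - 1` and `(r, s) ≠ (0, 0)`. -/
def frickeIndex (N : ℕ) : Set (ℚ × ℚ) :=
  {a | ∃ r s : ℕ, r < N ∧ s < N ∧ (r, s) ≠ (0, 0) ∧ a = ((r : ℚ) / N, (s : ℚ) / N)}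

end ModularFunctions

end

open ModularFunctions

/-! The proof is Galois theory for the action of `SL(2, ℤ)` on F_N by composition. `Γ(N)` acts
trivially and has finite index, so the image H of the action is finite, and by Artin's theorem F_N
is Galois with group H over its fixed field. Let E be the field generated by j and the Fricke
functions. If E contains the fixed field and only the identity of H fixes E elementwise, the Galois
correspondence gives E = F_N (`modularFunctionField_le`).

The fixed field lies in ℂ(j) (`toField_mem_adjoin_jFunction`). An invariant function has finitely
many poles in the fundamental domain; a polynomial in j removes them, and a power of Δ then turns
the product into a level one modular form of weight 12k. Such a form is Δ^k times a polynomial in j.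

The group-theoretic input is `fricke_smul_eq_iff`. The factor E₄E₆/Δ has weight -2 and ℘ at a
division point has weight 2, so f_a ∘ γ = f_{aγ}, with a a row vector modulo 1. It remains to see
that f_a = f_b only if b ≡ ±a. By equivariance a may be taken to be (0, y). The limit of ℘ at i∞ is
then compared: it contains the extra positive sum ∑ 1/(y - n)² exactly when the first coordinate is
0, and strict convexity of 1/u² shows that this sum determines y up to y ↦ 1 - y.

One estimate carries the analysis: on |Re z| ≤ A, Im z ≥ B the series of ℘ at a division point has a
summable majorant (`exists_norm_latticeTerm_le`). It gives holomorphy on ℍ, the limit at i∞ and the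
growth needed for meromorphy at the cusps. -/

namespace ModularFunctions

open scoped ModularForm

/-! ### Uniform majorant for the series of ℘ at division points -/

/-- The summand of the Weierstrass function `℘` of the lattice `ℤ z ⊕ ℤ`, at the point
`x z + y`, that belongs to the lattice point `l.1 z + l.2`. -/
noncomputable def latticeTerm (x y : ℝ) (l : ℤ × ℤ) (z : ℂ) : ℂ :=
  1 / ((x - l.1) * z + (y - l.2)) ^ 2 - 1 / (l.1 * z + l.2) ^ 2

/-- A summable function on `ℤ × ℤ` that dominates the summands of `℘`. -/
noncomputable def latticeMajorant (l : ℤ × ℤ) : ℝ :=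
  (max 1 |(l.1 : ℝ)|) ^ (-(3 / 2) : ℝ) * (max 1 |(l.2 : ℝ)|) ^ (-(3 / 2) : ℝ)

theorem summable_max_one_abs_rpow :
    Summable fun n : ℤ => (max 1 |(n : ℝ)|) ^ (-(3 / 2) : ℝ) := by
  have h : Summable fun n : ℤ => |(n : ℝ)| ^ (-(3 / 2) : ℝ) :=
    Real.summable_abs_int_rpow (by norm_num)
  refine h.congr_cofinite ?_
  have h₀ : ∀ᶠ n : ℤ in Filter.cofinite, n ≠ 0 := (Set.finite_singleton 0).compl_mem_cofinite
  filter_upwards [h₀] with n hn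
  rw [max_eq_right]
  exact_mod_cast Int.one_le_abs hn

theorem summable_latticeMajorant : Summable latticeMajorant :=
  summable_max_one_abs_rpow.mul_of_nonneg summable_max_one_abs_rpow
    (fun _ => by positivity) (fun _ => by positivity)

/-- The imaginary part controls x. The real part then controls y, at the cost of |x| |Re z| ≤ (A /
B) |x| Im z. Keeping the factor Im z on the left makes the bound usable as Im z → ∞. -/
theorem mul_im_add_abs_le_norm {A B : ℝ} (hA : 0 ≤ A) (hB : 0 < B) {z : ℂ} (hre : |z.re| ≤ A)
    (him : B ≤ z.im) (x y : ℝ) :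
    |x| * z.im + |y| ≤ (3 + A / B) * ‖(x * z + y : ℂ)‖ := by
  have h₁ : |x| * z.im ≤ ‖(x * z + y : ℂ)‖ := by
    have := Complex.abs_im_le_norm (x * z + y)
    simpa [abs_mul, abs_of_pos (hB.trans_le him)] using this
  have h₂ : |x * z.re + y| ≤ ‖(x * z + y : ℂ)‖ := by
    have := Complex.abs_re_le_norm (x * z + y)
    simpa using this
  have h₃ : |y| ≤ |x * z.re + y| + |x| * |z.re| := by
    rw [← abs_mul]
    have := abs_sub (x * z.re + y) (x * z.re)
    simpa using this
  have h₄ : |x| * |z.re| ≤ A / B * ‖(x * z + y : ℂ)‖ := by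
    calc |x| * |z.re| ≤ |x| * A := by gcongr
      _ = A / B * (|x| * B) := by field_simp
      _ ≤ A / B * (|x| * z.im) := by gcongr
      _ ≤ _ := by gcongr
  have h₅ := norm_nonneg (x * z + y : ℂ)
  linarith

theorem inv_mul_add_sq_le_latticeMajorant {l : ℤ × ℤ} (hl : l.1 ≠ 0) :
    1 / (|(l.1 : ℝ)| * (|(l.1 : ℝ)| + |(l.2 : ℝ)|) ^ 2) ≤ latticeMajorant l := by
  have h₁ : (1 : ℝ) ≤ |(l.1 : ℝ)| := by exact_mod_cast Int.one_le_abs hl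
  rw [latticeMajorant, max_eq_right h₁]
  set M := |(l.1 : ℝ)|
  set n := |(l.2 : ℝ)|
  have hn : 0 ≤ n := abs_nonneg _
  have hS : max 1 n ≤ M + n := max_le (by linarith) (by linarith)
  have hM : 0 < M := by linarith
  rw [Real.rpow_neg hM.le, Real.rpow_neg (by positivity), ← mul_inv, one_div]
  refine inv_anti₀ (by positivity) ?_
  -- Half a power of M + n is spent on M; the remaining power 3/2 dominates that of max 1 n.
  have e₁ : M ^ (3 / 2 : ℝ) = M * M ^ (1 / 2 : ℝ) := by
    nth_rw 2 [← Real.rpow_one M]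
    rw [← Real.rpow_add hM]
    norm_num
  have e₂ : (M + n) ^ 2 = (M + n) ^ (1 / 2 : ℝ) * (M + n) ^ (3 / 2 : ℝ) := by
    rw [← Real.rpow_add (by linarith), ← Real.rpow_natCast]
    norm_num
  rw [e₁, e₂, mul_assoc]
  gcongr
  linarith

theorem inv_sq_le_latticeMajorant {n : ℤ} (hn : n ≠ 0) :
    1 / (n : ℝ) ^ 2 ≤ latticeMajorant (0, n) := by
  have h₁ : (1 : ℝ) ≤ |(n : ℝ)| := by exact_mod_cast Int.one_le_abs hn
  rw [latticeMajorant, max_eq_right h₁, ← sq_abs]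
  simp only [Int.cast_zero, abs_zero, zero_le_one, sup_of_le_left, Real.one_rpow, one_mul]
  rw [Real.rpow_neg (by positivity), one_div]
  refine inv_anti₀ (by positivity) ?_
  rw [← Real.rpow_natCast]
  exact Real.rpow_le_rpow_of_exponent_le h₁ (by norm_num)

theorem min_le_abs_sub_intCast (x : ℝ) (m : ℤ) :
    min x (1 - x) ≤ |x - m| := by
  rcases le_or_gt m 0 with h | h
  · have : (m : ℝ) ≤ 0 := by exact_mod_cast h
    exact (min_le_left _ _).trans (le_abs.mpr (Or.inl (by linarith)))
  · have : (1 : ℝ) ≤ m := by exact_mod_cast h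
    exact (min_le_right _ _).trans (le_abs.mpr (Or.inr (by linarith)))

theorem norm_mul_add_le {A B x y : ℝ} (hA : 0 ≤ A) (hB : 0 < B) (hx : 0 ≤ x ∧ x < 1)
    (hy : 0 ≤ y ∧ y < 1) {z : ℂ} (hre : |z.re| ≤ A) (him : B ≤ z.im) :
    ‖(x * z + y : ℂ)‖ ≤ ((A + 1) / B + 1) * z.im := by
  have h₁ : ‖(x * z + y : ℂ)‖ ≤ 1 * ‖z‖ + 1 := by
    refine (norm_add_le _ _).trans ?_
    rw [norm_mul, Complex.norm_of_nonneg hx.1, Complex.norm_of_nonneg hy.1]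
    have := norm_nonneg z
    gcongr
    exacts [hx.2.le, hy.2.le]
  have h₂ := Complex.norm_le_abs_re_add_abs_im z
  rw [abs_of_pos (hB.trans_le him)] at h₂
  have h₃ : A + 1 ≤ (A + 1) / B * z.im := by
    rw [div_mul_eq_mul_div, le_div_iff₀ hB]
    gcongr
  linarith

/-- If x = 0, the point y is bounded and its distance to the lattice is bounded below. If x ≠ 0, the
distance is at least min x (1 - x) times Im z, while x z + y is itself O(Im z), so the ratio stays
bounded as Im z → ∞. -/
theorem exists_norm_sub_lattice_bound {A B x y : ℝ} (hA : 0 ≤ A) (hB : 0 < B)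
    (hx : 0 ≤ x ∧ x < 1) (hy : 0 ≤ y ∧ y < 1) (hxy : x ≠ 0 ∨ y ≠ 0) :
    ∃ κ > 0, ∃ K ≥ 0, ∀ (l : ℤ × ℤ) (z : ℂ), |z.re| ≤ A → B ≤ z.im →
      κ ≤ ‖((x - l.1) * z + (y - l.2) : ℂ)‖ ∧
      ‖(x * z + y : ℂ)‖ ≤ K * ‖((x - l.1) * z + (y - l.2) : ℂ)‖ := by
  have him' : ∀ (l : ℤ × ℤ) (z : ℂ), B ≤ z.im →
      |x - l.1| * z.im ≤ ‖((x - l.1) * z + (y - l.2) : ℂ)‖ := fun l z hz => by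
    have := Complex.abs_im_le_norm ((x - l.1) * z + (y - l.2) : ℂ)
    simpa [abs_mul, abs_of_pos (hB.trans_le hz)] using this
  by_cases hx0 : x = 0
  · have hy0 : 0 < y := lt_of_le_of_ne hy.1 (hxy.resolve_left (not_not.mpr hx0)).symm
    have hκ : 0 < min B (min y (1 - y)) := lt_min hB (lt_min hy0 (by linarith))
    have key : ∀ (l : ℤ × ℤ) (z : ℂ), |z.re| ≤ A → B ≤ z.im →
        min B (min y (1 - y)) ≤ ‖((x - l.1) * z + (y - l.2) : ℂ)‖ := by
      intro l z _ hz
      by_cases hl : l.1 = 0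
      · have := min_le_abs_sub_intCast y l.2
        refine (min_le_right _ _).trans (this.trans (le_of_eq ?_))
        rw [hx0, hl]
        simp only [Complex.ofReal_zero, Int.cast_zero, sub_self, zero_mul, zero_add]
        rw [← Real.norm_eq_abs, ← Complex.norm_real]
        push_cast
        rfl
      · refine (min_le_left _ _).trans (le_trans ?_ (him' l z hz))
        have h₁ : (1 : ℝ) ≤ |x - l.1| := by
          rw [hx0, zero_sub, abs_neg]
          exact_mod_cast Int.one_le_abs hl
        nlinarith
    refine ⟨_, hκ, 1 / min B (min y (1 - y)), by positivity, fun l z h₁ h₂ =>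
      ⟨key l z h₁ h₂, ?_⟩⟩
    rw [div_mul_eq_mul_div, le_div_iff₀ hκ, one_mul]
    have h₃ : ‖(x * z + y : ℂ)‖ ≤ 1 := by
      rw [hx0]
      simp only [Complex.ofReal_zero, zero_mul, zero_add]
      rw [Complex.norm_of_nonneg hy.1]
      exact hy.2.le
    calc _ ≤ 1 * min B (min y (1 - y)) := by gcongr
      _ ≤ _ := by rw [one_mul]; exact key l z h₁ h₂
  · have hx0' : 0 < x := lt_of_le_of_ne hx.1 (Ne.symm hx0)
    have hδ : 0 < min x (1 - x) := lt_min hx0' (by linarith)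
    have key : ∀ (l : ℤ × ℤ) (z : ℂ), B ≤ z.im →
        min x (1 - x) * z.im ≤ ‖((x - l.1) * z + (y - l.2) : ℂ)‖ := fun l z hz => by
      refine le_trans ?_ (him' l z hz)
      have : 0 < z.im := hB.trans_le hz
      gcongr
      exact min_le_abs_sub_intCast x l.1
    refine ⟨min x (1 - x) * B, by positivity, ((A + 1) / B + 1) / min x (1 - x), by positivity,
      fun l z h₁ h₂ => ⟨le_trans (by gcongr) (key l z h₂), ?_⟩⟩
    refine (norm_mul_add_le hA hB hx hy h₁ h₂).trans ?_
    rw [div_mul_eq_mul_div, le_div_iff₀ hδ, mul_assoc, mul_comm z.im]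
    gcongr
    exact key l z h₂

/-- Both bounds come from 1/w² - 1/l² = p (l - w) / (w² l²), with |l - w| and |l| bounded by
multiples of |w|. The first is free of p and serves the row of real lattice points; the second gains
a power of |l| and serves the other rows. -/
theorem norm_inv_sq_sub_inv_sq_le {p w l : ℂ} {K : ℝ} (hK : 0 ≤ K) (hp : p = w + l) (hl : l ≠ 0)
    (hw : w ≠ 0) (hpw : ‖p‖ ≤ K * ‖w‖) :
    ‖1 / w ^ 2 - 1 / l ^ 2‖ ≤ K * (K + 2) / ‖l‖ ^ 2 ∧
      ‖1 / w ^ 2 - 1 / l ^ 2‖ ≤ (K + 1) * (K + 2) * (‖p‖ / ‖l‖ ^ 3) := by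
  have hl' : 0 < ‖l‖ := norm_pos_iff.mpr hl
  have hw' : 0 < ‖w‖ := norm_pos_iff.mpr hw
  have hlw : ‖l‖ ≤ (K + 1) * ‖w‖ := by
    have : l = p - w := by rw [hp]; ring
    rw [this]
    refine (norm_sub_le _ _).trans ?_
    linarith
  have e : 1 / w ^ 2 - 1 / l ^ 2 = p * (l - w) / (w ^ 2 * l ^ 2) := by
    rw [hp]
    field_simp
    ring
  have h₁ : ‖1 / w ^ 2 - 1 / l ^ 2‖ ≤ (K + 2) * (‖p‖ / (‖w‖ * ‖l‖ ^ 2)) := by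
    rw [e, norm_div, norm_mul, norm_mul, norm_pow, norm_pow]
    have : ‖l - w‖ ≤ (K + 2) * ‖w‖ := (norm_sub_le _ _).trans (by linarith)
    calc _ ≤ ‖p‖ * ((K + 2) * ‖w‖) / (‖w‖ ^ 2 * ‖l‖ ^ 2) := by gcongr
      _ = _ := by field_simp
  refine ⟨h₁.trans ?_, h₁.trans ?_⟩
  · calc _ ≤ (K + 2) * (K * ‖w‖ / (‖w‖ * ‖l‖ ^ 2)) := by gcongr
      _ = _ := by field_simp
  · have : ‖p‖ / (‖w‖ * ‖l‖ ^ 2) ≤ (K + 1) * (‖p‖ / ‖l‖ ^ 3) := by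
      rw [mul_div_assoc', div_le_div_iff₀ (by positivity) (by positivity)]
      calc ‖p‖ * ‖l‖ ^ 3 = ‖p‖ * (‖l‖ * ‖l‖ ^ 2) := by ring
        _ ≤ ‖p‖ * ((K + 1) * ‖w‖ * ‖l‖ ^ 2) := by gcongr
        _ = _ := by ring
    calc _ ≤ (K + 2) * ((K + 1) * (‖p‖ / ‖l‖ ^ 3)) := by gcongr
      _ = _ := by ring

/-- The imaginary part is unbounded above, so the same majorant serves for local uniform convergence
and for the limit at i∞. -/
theorem exists_norm_latticeTerm_le {A B x y : ℝ} (hA : 0 ≤ A) (hB : 0 < B)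
    (hx : 0 ≤ x ∧ x < 1) (hy : 0 ≤ y ∧ y < 1) (hxy : x ≠ 0 ∨ y ≠ 0) :
    ∃ C : ℝ, ∀ (l : ℤ × ℤ) (z : ℂ), |z.re| ≤ A → B ≤ z.im →
      ‖latticeTerm x y l z‖ ≤ C * latticeMajorant l := by
  obtain ⟨κ, hκ, K, hK, H⟩ := exists_norm_sub_lattice_bound hA hB hx hy hxy
  set P := (A + 1) / B + 1 with hP
  set c := 3 + A / B with hc
  have hP0 : 0 < P := by positivity
  have hc0 : 0 < c := by positivity
  set b := min B 1 with hb
  have hb0 : 0 < b := lt_min hB one_pos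
  have hmaj : ∀ l, 0 ≤ latticeMajorant l := fun l => by unfold latticeMajorant; positivity
  set C₂ := (K + 1) * (K + 2) * (P * (c / b) ^ 2) with hC₂
  have hC₂0 : 0 ≤ C₂ := by positivity
  refine ⟨1 / κ ^ 2 + K * (K + 2) + C₂, fun l z hre him => ?_⟩
  have hz : 0 < z.im := hB.trans_le him
  obtain ⟨Hκ, HK⟩ := H l z hre him
  have hw : ((x - l.1) * z + (y - l.2) : ℂ) ≠ 0 := norm_pos_iff.mp (hκ.trans_le Hκ)
  have hD := mul_im_add_abs_le_norm hA hB hre him l.1 l.2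
  simp only [Complex.ofReal_intCast] at hD
  by_cases hl : l.1 = 0
  · by_cases hl2 : l.2 = 0
    · have h1 : latticeMajorant l = 1 := by simp [latticeMajorant, hl, hl2]
      have : ‖latticeTerm x y l z‖ ≤ 1 / κ ^ 2 := by
        have h0 : (l.1 * z + l.2 : ℂ) = 0 := by simp [hl, hl2]
        -- At the lattice point 0 the subtracted term is 1 / 0 = 0, so only the principal part of ℘
        -- remains.
        rw [latticeTerm, h0, zero_pow two_ne_zero, div_zero, sub_zero,
          norm_div, norm_pow, norm_one]
        gcongr
      rw [h1, mul_one]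
      have : 0 ≤ K * (K + 2) := by positivity
      linarith
    · have hl2' : ((l.1 : ℂ) * z + l.2) ≠ 0 := by
        rw [hl, Int.cast_zero, zero_mul, zero_add]
        exact_mod_cast hl2
      -- Here |l| does not grow with Im z, so the bound containing |p| would not be uniform.
      have h₁ := (norm_inv_sq_sub_inv_sq_le hK (p := x * z + y) (by ring) hl2' hw HK).1
      have h₂ : K * (K + 2) / ‖((l.1 : ℂ) * z + l.2)‖ ^ 2 ≤ K * (K + 2) * latticeMajorant l := by
        have h₃ := inv_sq_le_latticeMajorant hl2
        rw [show ((0 : ℤ), l.2) = l from Prod.ext hl.symm rfl] at h₃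
        rw [div_eq_mul_one_div]
        gcongr
        rw [hl, Int.cast_zero, zero_mul, zero_add, Complex.norm_intCast, sq_abs]
        exact h₃
      refine (h₁.trans h₂).trans ?_
      have := hmaj l
      gcongr
      have : 0 ≤ 1 / κ ^ 2 := by positivity
      linarith
  · have h1 : (1 : ℝ) ≤ |(l.1 : ℝ)| := by exact_mod_cast Int.one_le_abs hl
    have hl1 : |(l.1 : ℝ)| * z.im ≤ ‖((l.1 : ℂ) * z + l.2)‖ := by
      have := Complex.abs_im_le_norm ((l.1 : ℂ) * z + l.2)
      simpa [abs_mul, abs_of_pos hz] using this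
    have hlpos : 0 < ‖((l.1 : ℂ) * z + l.2)‖ := lt_of_lt_of_le (by positivity) hl1
    have h₁ := (norm_inv_sq_sub_inv_sq_le hK (p := x * z + y) (by ring)
      (norm_pos_iff.mp hlpos) hw HK).2
    have h₂ : (|(l.1 : ℝ)| + |(l.2 : ℝ)|) ≤ c / b * ‖((l.1 : ℂ) * z + l.2)‖ := by
      rw [div_mul_eq_mul_div, le_div_iff₀ hb0]
      refine le_trans ?_ hD
      have : b ≤ z.im := (min_le_left _ _).trans him
      have : b ≤ 1 := min_le_right _ _
      rw [add_mul]
      gcongr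
      exact mul_le_of_le_one_right (abs_nonneg _) this
    -- The growth |p| ≤ P Im z is absorbed by one factor |l| ≥ |l.1| Im z; the other two factors
    -- give (|l.1| + |l.2|)².
    have h₃ : ‖(x * z + y : ℂ)‖ / ‖((l.1 : ℂ) * z + l.2)‖ ^ 3 ≤
        P * (c / b) ^ 2 * latticeMajorant l := by
      calc _ ≤ P * z.im / ‖((l.1 : ℂ) * z + l.2)‖ ^ 3 := by
            gcongr
            exact norm_mul_add_le hA hB hx hy hre him
        _ = P * (z.im / ‖((l.1 : ℂ) * z + l.2)‖) * (1 / ‖((l.1 : ℂ) * z + l.2)‖ ^ 2) := by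
            field_simp
        _ ≤ P * (1 / |(l.1 : ℝ)|) * ((c / b) ^ 2 / (|(l.1 : ℝ)| + |(l.2 : ℝ)|) ^ 2) := by
            refine mul_le_mul (mul_le_mul_of_nonneg_left ?_ hP0.le) ?_ (by positivity)
              (by positivity)
            · rw [div_le_div_iff₀ hlpos (by positivity)]
              linarith
            · rw [div_le_div_iff₀ (by positivity) (by positivity), one_mul, ← mul_pow]
              gcongr
        _ = P * (c / b) ^ 2 * (1 / (|(l.1 : ℝ)| * (|(l.1 : ℝ)| + |(l.2 : ℝ)|) ^ 2)) := by
            field_simp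
        _ ≤ _ := by
            gcongr
            exact inv_mul_add_sq_le_latticeMajorant hl
    calc _ ≤ _ := h₁
      _ ≤ (K + 1) * (K + 2) * (P * (c / b) ^ 2 * latticeMajorant l) := by gcongr
      _ = C₂ * latticeMajorant l := by rw [hC₂]; ring
      _ ≤ _ := by
        have := hmaj l
        gcongr
        have : 0 ≤ 1 / κ ^ 2 := by positivity
        have : 0 ≤ K * (K + 2) := by positivity
        linarith


/-! ### Behaviour of division values, Fricke functions and j under `SL(2, ℤ)` -/

/-- The value `℘_{L_τ}(a₁ τ + a₂)`. -/
noncomputable def divisionValue (a : ℚ × ℚ) (τ : ℍ) : ℂ :=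
  (periodPair τ).weierstrassP ((a.1 : ℂ) * (τ : ℂ) + (a.2 : ℂ))

theorem tsum_lattice_periodPair (τ : ℍ) (φ : ℂ → ℂ) :
    ∑' l : (periodPair τ).lattice, φ l = ∑' l : ℤ × ℤ, φ (l.1 * τ + l.2) := by
  rw [← (periodPair τ).latticeEquivProd.symm.toEquiv.tsum_eq]
  refine tsum_congr fun l => ?_
  have h := (periodPair τ).latticeEquiv_symm_apply l
  simp only [LinearEquiv.coe_toEquiv, h]
  simp [periodPair]

theorem divisionValue_eq_tsum (a : ℚ × ℚ) (τ : ℍ) :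
    divisionValue a τ = ∑' l : ℤ × ℤ, latticeTerm (a.1 : ℝ) (a.2 : ℝ) l τ := by
  rw [divisionValue, PeriodPair.weierstrassP,
    tsum_lattice_periodPair τ fun w => 1 / ((a.1 : ℂ) * τ + a.2 - w) ^ 2 - 1 / w ^ 2]
  refine tsum_congr fun l => ?_
  rw [latticeTerm]
  push_cast
  congr 3
  ring

theorem divisionValue_add_int (a : ℚ × ℚ) (m n : ℤ) (τ : ℍ) :
    divisionValue (a.1 + m, a.2 + n) τ = divisionValue a τ := by
  have hl : (m * τ + n : ℂ) ∈ (periodPair τ).lattice :=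
    PeriodPair.mem_lattice.mpr ⟨m, n, by simp [periodPair]⟩
  have h := (periodPair τ).weierstrassP_add_coe ((a.1 : ℂ) * τ + a.2) ⟨_, hl⟩
  rw [divisionValue, divisionValue, ← h]
  push_cast
  congr 1
  ring

/-- The right action of `SL(2, ℤ)` on row vectors. -/
def rowMul {R : Type*} [CommRing R] (a : R × R) (γ : SL(2, ℤ)) : R × R :=
  (a.1 * (γ 0 0 : ℤ) + a.2 * (γ 1 0 : ℤ), a.1 * (γ 0 1 : ℤ) + a.2 * (γ 1 1 : ℤ))

theorem rowMul_mul {R : Type*} [CommRing R] (a : R × R) (γ δ : SL(2, ℤ)) :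
    rowMul a (γ * δ) = rowMul (rowMul a γ) δ := by
  simp only [rowMul, Matrix.SpecialLinearGroup.coe_mul, Matrix.mul_apply, Fin.sum_univ_two]
  push_cast
  ext <;> simp only <;> ring

theorem rowMul_one {R : Type*} [CommRing R] (a : R × R) : rowMul a 1 = a := by
  simp [rowMul]

theorem rowMul_neg_left {R : Type*} [CommRing R] (a : R × R) (γ : SL(2, ℤ)) :
    rowMul (-a) γ = -rowMul a γ := by
  ext <;> simp [rowMul] <;> ring

/-- `SL(2, ℤ)` permutes the pairs of integers. -/
def rowMulEquiv (γ : SL(2, ℤ)) : ℤ × ℤ ≃ ℤ × ℤ where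
  toFun l := rowMul l γ
  invFun l := rowMul l γ⁻¹
  left_inv l := by simp only; rw [← rowMul_mul, mul_inv_cancel, rowMul_one]
  right_inv l := by simp only; rw [← rowMul_mul, inv_mul_cancel, rowMul_one]

/-- The automorphy factor `c τ + d`. -/
noncomputable def automorphyFactor (γ : SL(2, ℤ)) (τ : ℍ) : ℂ := (γ 1 0 : ℤ) * (τ : ℂ) + (γ 1 1 : ℤ)

theorem automorphyFactor_eq_denom (γ : SL(2, ℤ)) (τ : ℍ) :
    automorphyFactor γ τ = denom γ τ := by
  simp [automorphyFactor, denom]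

theorem automorphyFactor_ne_zero (γ : SL(2, ℤ)) (τ : ℍ) : automorphyFactor γ τ ≠ 0 := by
  rw [automorphyFactor_eq_denom]
  exact denom_ne_zero _ _

theorem coe_smul_eq_div (γ : SL(2, ℤ)) (τ : ℍ) :
    ((γ • τ : ℍ) : ℂ) = ((γ 0 0 : ℤ) * (τ : ℂ) + (γ 0 1 : ℤ)) / automorphyFactor γ τ := by
  rw [specialLinearGroup_apply]
  simp [automorphyFactor]

theorem mul_smul_add_eq_div (γ : SL(2, ℤ)) (τ : ℍ) (x : ℂ × ℂ) :
    x.1 * ((γ • τ : ℍ) : ℂ) + x.2 =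
      ((rowMul x γ).1 * τ + (rowMul x γ).2) / automorphyFactor γ τ := by
  have h := automorphyFactor_ne_zero γ τ
  rw [coe_smul_eq_div, eq_div_iff h]
  field_simp
  simp only [rowMul, automorphyFactor]
  ring

/-- The weight 2 law of ℘ holds term by term once the lattice points are permuted by l ↦ lγ. -/
theorem latticeTerm_smul (a : ℚ × ℚ) (l : ℤ × ℤ) (γ : SL(2, ℤ)) (τ : ℍ) :
    latticeTerm (a.1 : ℝ) (a.2 : ℝ) l ((γ • τ : ℍ) : ℂ) = automorphyFactor γ τ ^ 2 *
      latticeTerm ((rowMul a γ).1 : ℝ) ((rowMul a γ).2 : ℝ) (rowMul l γ) τ := by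
  have h₁ := mul_smul_add_eq_div γ τ ((a.1 : ℂ) - l.1, (a.2 : ℂ) - l.2)
  have h₂ := mul_smul_add_eq_div γ τ ((l.1 : ℂ), (l.2 : ℂ))
  simp only [latticeTerm]
  push_cast
  simp only at h₁ h₂
  rw [h₁, h₂]
  rw [div_pow, div_pow, one_div_div, one_div_div, mul_sub, mul_one_div, mul_one_div]
  simp only [rowMul]
  push_cast
  congr 3
  ring

theorem divisionValue_smul (a : ℚ × ℚ) (γ : SL(2, ℤ)) (τ : ℍ) :
    divisionValue a (γ • τ) = automorphyFactor γ τ ^ 2 * divisionValue (rowMul a γ) τ := by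
  rw [divisionValue_eq_tsum, divisionValue_eq_tsum, ← tsum_mul_left,
    ← (rowMulEquiv γ).tsum_eq (fun l => automorphyFactor γ τ ^ 2 *
      latticeTerm ((rowMul a γ).1 : ℝ) ((rowMul a γ).2 : ℝ) l τ)]
  exact tsum_congr fun l => latticeTerm_smul a l γ τ

/-- Sorting the nonzero lattice points by the gcd of their coordinates splits off ζ(k); the factor 2
undoes the 1/2 in the normalization of `ModularForm.E`. -/
theorem G_periodPair {k : ℕ} (hk : 3 ≤ k) (τ : ℍ) :
    (periodPair τ).G k = 2 * riemannZeta k * ModularForm.E hk τ := by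
  have h₁ : (periodPair τ).G k = ∑' v : Fin 2 → ℤ, EisensteinSeries.eisSummand k v τ := by
    rw [PeriodPair.G, tsum_lattice_periodPair τ fun w => (w ^ k)⁻¹,
      ← (finTwoArrowEquiv ℤ).tsum_eq]
    refine tsum_congr fun v => ?_
    simp [EisensteinSeries.eisSummand]
  have h₂ : ModularForm.E hk τ = (1 / 2 : ℂ) * eisensteinSeries (N := 1) 0 k τ := rfl
  rw [h₁, h₂, tsum_eisSummand_eq_riemannZeta_mul_eisensteinSeries hk]
  ring

theorem g₂_periodPair (τ : ℍ) :
    (periodPair τ).g₂ = 4 / 3 * (Real.pi : ℂ) ^ 4 * ModularForm.E₄ τ := by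
  rw [PeriodPair.g₂, G_periodPair (k := 4) (by norm_num)]
  push_cast
  rw [riemannZeta_four]
  ring

theorem g₃_periodPair (τ : ℍ) :
    (periodPair τ).g₃ = 8 / 27 * (Real.pi : ℂ) ^ 6 * ModularForm.E₆ τ := by
  have h : riemannZeta (6 : ℕ) = (Real.pi : ℂ) ^ 6 / 945 := by
    have h₁ := riemannZeta_two_mul_nat (k := 3) (by norm_num)
    have h₂ : bernoulli 6 = 1 / 42 := by decide +kernel
    norm_num [h₂, Nat.factorial] at h₁
    rw [show ((6 : ℕ) : ℂ) = 6 by norm_num, h₁]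
    ring
  rw [PeriodPair.g₃, G_periodPair (k := 6) (by norm_num), h]
  ring

/-- The constant `g₂ g₃ / (g₂³ - 27 g₃²)` divided by `E₄ E₆ / Δ`. -/
noncomputable def frickeConst : ℂ := 1 / (10368 * (Real.pi : ℂ) ^ 2)

theorem frickeConst_ne_zero : frickeConst ≠ 0 := by
  have := Real.pi_ne_zero
  simp [frickeConst, this]

theorem fricke_eq (a : ℚ × ℚ) (τ : ℍ) :
    fricke a τ = frickeConst * (ModularForm.E₄ τ * ModularForm.E₆ τ /
      ModularForm.discriminant τ) * divisionValue a τ := by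
  have hpi : (Real.pi : ℂ) ≠ 0 := by exact_mod_cast Real.pi_ne_zero
  have hΔ := ModularForm.discriminant_ne_zero τ
  have h : (periodPair τ).g₂ ^ 3 - 27 * (periodPair τ).g₃ ^ 2 =
      4096 * (Real.pi : ℂ) ^ 12 * ModularForm.discriminant τ := by
    rw [g₂_periodPair, g₃_periodPair, ModularForm.discriminant_eq_E₄_cube_sub_E₆_sq]
    ring
  rw [fricke, ← divisionValue, h, g₂_periodPair, g₃_periodPair, frickeConst]
  field_simp
  ring

theorem levelOne_smul {k : ℤ} (f : ModularForm 𝒮ℒ k) (γ : SL(2, ℤ)) (τ : ℍ) :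
    f (γ • τ) = automorphyFactor γ τ ^ k * f τ := by
  have h : (f : ℍ → ℂ) ∣[k] γ = f := SlashInvariantFormClass.slash_action_eq f _ ⟨γ, rfl⟩
  have h₁ := congrFun h τ
  rw [ModularForm.SL_slash_apply, ← automorphyFactor_eq_denom] at h₁
  rw [← h₁, mul_comm, mul_assoc, ← zpow_add₀ (automorphyFactor_ne_zero γ τ)]
  simp

theorem discriminant_smul (γ : SL(2, ℤ)) (τ : ℍ) :
    ModularForm.discriminant (γ • τ) = automorphyFactor γ τ ^ 12 * ModularForm.discriminant τ := by
  rw [ModularForm.discriminant_eq_E₄_cube_sub_E₆_sq, ModularForm.discriminant_eq_E₄_cube_sub_E₆_sq,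
    levelOne_smul, levelOne_smul]
  norm_cast
  ring

/-- The weight 4 + 6 - 12 = -2 of E₄E₆/Δ cancels the weight 2 of ℘. -/
theorem fricke_smul (a : ℚ × ℚ) (γ : SL(2, ℤ)) (τ : ℍ) :
    fricke a (γ • τ) = fricke (rowMul a γ) τ := by
  have h := automorphyFactor_ne_zero γ τ
  have hΔ := ModularForm.discriminant_ne_zero τ
  rw [fricke_eq, fricke_eq, levelOne_smul, levelOne_smul, discriminant_smul, divisionValue_smul]
  norm_cast
  field_simp

theorem fricke_add_int (a : ℚ × ℚ) (m n : ℤ) : fricke (a.1 + m, a.2 + n) = fricke a := by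
  ext τ
  rw [fricke_eq, fricke_eq, divisionValue_add_int]

theorem jFunction_eq (τ : ℍ) :
    jFunction τ = ModularForm.E₄ τ ^ 3 / ModularForm.discriminant τ := by
  rw [jFunction, ModularForm.discriminant_eq_E₄_cube_sub_E₆_sq]

theorem jFunction_smul (γ : SL(2, ℤ)) (τ : ℍ) : jFunction (γ • τ) = jFunction τ := by
  have h := automorphyFactor_ne_zero γ τ
  have hΔ := ModularForm.discriminant_ne_zero τ
  rw [jFunction_eq, jFunction_eq, levelOne_smul, discriminant_smul]
  norm_cast
  field_simp

/-! ### Holomorphy on the upper half-plane -/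

theorem analyticAt_modularForm {k : ℤ} (f : ModularForm 𝒮ℒ k) (τ : ℍ) :
    AnalyticAt ℂ (f ∘ ofComplex) τ :=
  (UpperHalfPlane.mdifferentiable_iff.mp f.holo').analyticAt
    (isOpen_upperHalfPlaneSet.mem_nhds τ.im_pos)

theorem analyticAt_discriminant (τ : ℍ) :
    AnalyticAt ℂ (ModularForm.discriminant ∘ ofComplex) τ :=
  (UpperHalfPlane.mdifferentiable_iff.mp CuspForm.discriminant.holo').analyticAt
    (isOpen_upperHalfPlaneSet.mem_nhds τ.im_pos)

theorem analyticAt_jFunction (τ : ℍ) : AnalyticAt ℂ (jFunction ∘ ofComplex) τ := by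
  have h : jFunction ∘ ofComplex = fun z => (ModularForm.E₄ ∘ ofComplex) z ^ 3 /
      (ModularForm.discriminant ∘ ofComplex) z := by
    ext z
    exact jFunction_eq _
  rw [h]
  exact ((analyticAt_modularForm _ τ).pow 3).div (analyticAt_discriminant τ)
    (ModularForm.discriminant_ne_zero _)

theorem frickeIndex_bounds {N : ℕ} {a : ℚ × ℚ} (ha : a ∈ frickeIndex N) :
    (0 ≤ (a.1 : ℝ) ∧ (a.1 : ℝ) < 1) ∧ (0 ≤ (a.2 : ℝ) ∧ (a.2 : ℝ) < 1) ∧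
      ((a.1 : ℝ) ≠ 0 ∨ (a.2 : ℝ) ≠ 0) := by
  obtain ⟨r, s, hr, hs, hne, rfl⟩ := ha
  have hN : (0 : ℝ) < N := by exact_mod_cast (Nat.zero_le r).trans_lt hr
  push_cast
  refine ⟨⟨by positivity, (div_lt_one hN).mpr (by exact_mod_cast hr)⟩,
    ⟨by positivity, (div_lt_one hN).mpr (by exact_mod_cast hs)⟩, ?_⟩
  by_contra! h
  simp only [div_eq_zero_iff, Nat.cast_eq_zero, hN.ne', or_false] at h
  exact hne (by simpa using h)

theorem analyticAt_divisionValue {N : ℕ} {a : ℚ × ℚ} (ha : a ∈ frickeIndex N) (τ : ℍ) :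
    AnalyticAt ℂ (divisionValue a ∘ ofComplex) τ := by
  obtain ⟨hx, hy, hxy⟩ := frickeIndex_bounds ha
  set A := |τ.re| + 1
  set B := τ.im / 2
  have hB : 0 < B := half_pos τ.im_pos
  obtain ⟨C, hC⟩ := exists_norm_latticeTerm_le (A := A) (by positivity) hB hx hy hxy
  obtain ⟨κ, hκ, K, -, H⟩ := exists_norm_sub_lattice_bound (A := A) (by positivity) hB hx hy hxy
  set U : Set ℂ := {z | |z.re| < A ∧ B < z.im}
  have hU : IsOpen U := (isOpen_lt (by fun_prop : Continuous fun z : ℂ => |z.re|)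
    continuous_const).inter (isOpen_lt continuous_const Complex.continuous_im)
  have hτ : (τ : ℂ) ∈ U := ⟨lt_add_one _, half_lt_self τ.im_pos⟩
  have hd : DifferentiableOn ℂ (fun z => ∑' l, latticeTerm (a.1 : ℝ) (a.2 : ℝ) l z) U := by
    refine Complex.differentiableOn_tsum_of_summable_norm (summable_latticeMajorant.mul_left C)
      (fun l => ?_) hU (fun l z hz => hC l z hz.1.le hz.2.le)
    intro z hz
    have h₁ := norm_pos_iff.mp (hκ.trans_le (H l z hz.1.le hz.2.le).1)
    refine DifferentiableAt.differentiableWithinAt ?_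
    unfold latticeTerm
    refine DifferentiableAt.sub ?_ ?_
    · exact (differentiableAt_const _).div (by fun_prop) (pow_ne_zero 2 h₁)
    · by_cases hl : l = 0
      -- For l = 0 the subtracted term is the constant 1 / 0 = 0, so it has no singularity.
      · simp [hl]
      · refine (differentiableAt_const _).div (by fun_prop) (pow_ne_zero 2 fun h => hl ?_)
        have h₂ : l.1 = 0 := by
          have := congrArg Complex.im h
          simpa [(hB.trans hz.2).ne'] using this
        rw [h₂] at h
        simp only [Int.cast_zero, zero_mul, zero_add, Int.cast_eq_zero] at h
        exact Prod.ext h₂ h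
  have he : (divisionValue a ∘ ofComplex) =ᶠ[nhds (τ : ℂ)]
      fun z => ∑' l, latticeTerm (a.1 : ℝ) (a.2 : ℝ) l z := by
    filter_upwards [hU.mem_nhds hτ] with z hz
    rw [Function.comp_apply, divisionValue_eq_tsum, ofComplex_apply_of_im_pos (hB.trans hz.2)]
  exact (hd.analyticAt (hU.mem_nhds hτ)).congr he.symm

theorem analyticAt_fricke {N : ℕ} {a : ℚ × ℚ} (ha : a ∈ frickeIndex N) (τ : ℍ) :
    AnalyticAt ℂ (fricke a ∘ ofComplex) τ := by
  have h : fricke a ∘ ofComplex = fun z => frickeConst * ((ModularForm.E₄ ∘ ofComplex) z *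
      (ModularForm.E₆ ∘ ofComplex) z / (ModularForm.discriminant ∘ ofComplex) z) *
      (divisionValue a ∘ ofComplex) z := by
    ext z
    exact fricke_eq _ _
  rw [h]
  exact (analyticAt_const.mul (((analyticAt_modularForm _ τ).mul
    (analyticAt_modularForm _ τ)).div (analyticAt_discriminant τ)
    (ModularForm.discriminant_ne_zero _))).mul (analyticAt_divisionValue ha τ)

theorem exists_norm_divisionValue_le {N : ℕ} {a : ℚ × ℚ} (ha : a ∈ frickeIndex N) {A B : ℝ}
    (hA : 0 ≤ A) (hB : 0 < B) :
    ∃ C, ∀ τ : ℍ, |τ.re| ≤ A → B ≤ τ.im → ‖divisionValue a τ‖ ≤ C := by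
  obtain ⟨hx, hy, hxy⟩ := frickeIndex_bounds ha
  obtain ⟨C, hC⟩ := exists_norm_latticeTerm_le hA hB hx hy hxy
  refine ⟨∑' l, C * latticeMajorant l, fun τ h₁ h₂ => ?_⟩
  rw [divisionValue_eq_tsum]
  exact tsum_of_norm_bounded (summable_latticeMajorant.mul_left C).hasSum fun l => hC l τ h₁ h₂

/-! ### Limits at i∞ and the separation of division points -/

theorem tendsto_E_atImInfty {k : ℕ} (hk : 3 ≤ k) (hk2 : Even k) :
    Filter.Tendsto (ModularForm.E hk) atImInfty (nhds 1) := by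
  have h₁ := ModularFormClass.analyticAt_cuspFunction_zero (ModularForm.E hk) one_pos
    one_mem_strictPeriods_SL
  have h₂ : cuspFunction 1 (ModularForm.E hk) 0 = 1 := by
    rw [← EisensteinSeries.E_qExpansion_coeff_zero hk hk2]
    simp [qExpansion_coeff]
  rw [← h₂]
  exact (h₁.continuousAt.tendsto.comp (qParam_tendsto_atImInfty one_pos)).congr
    (fun τ => SlashInvariantFormClass.eq_cuspFunction (ModularForm.E hk) τ
      one_mem_strictPeriods_SL one_ne_zero)

/-- The point `i t` of the upper half-plane (`i` if `t ≤ 0`). -/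
noncomputable def imagPoint (t : ℝ) : ℍ := ofComplex (Complex.I * t)

theorem coe_imagPoint {t : ℝ} (ht : 0 < t) : (imagPoint t : ℂ) = Complex.I * t := by
  rw [imagPoint, ofComplex_apply_of_im_pos (by simpa using ht)]

theorem im_imagPoint {t : ℝ} (ht : 0 < t) : (imagPoint t).im = t := by
  rw [← coe_im, coe_imagPoint ht]
  simp

theorem tendsto_imagPoint : Filter.Tendsto imagPoint Filter.atTop atImInfty := by
  rw [atImInfty, Filter.tendsto_comap_iff]
  refine Filter.tendsto_id.congr' ?_
  filter_upwards [Filter.eventually_gt_atTop 0] with t ht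
  exact (im_imagPoint ht).symm

theorem tendsto_inv_sq_mul_add {x : ℝ} (y : ℝ) :
    Filter.Tendsto (fun t : ℝ => 1 / ((x : ℂ) * (Complex.I * t) + y) ^ 2) Filter.atTop
      (nhds (if x = 0 then 1 / (y : ℂ) ^ 2 else 0)) := by
  split_ifs with hx
  · simp [hx]
  · rw [tendsto_zero_iff_norm_tendsto_zero]
    have h₁ : Filter.Tendsto (fun t : ℝ => 1 / (|x| * t) ^ 2) Filter.atTop (nhds 0) := by
      refine (tendsto_const_nhds (x := (1 : ℝ))).div_atTop ?_
      exact (Filter.tendsto_pow_atTop two_ne_zero).comp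
        (Filter.tendsto_id.const_mul_atTop (abs_pos.mpr hx))
    refine squeeze_zero' (Filter.Eventually.of_forall fun t => norm_nonneg _) ?_ h₁
    filter_upwards [Filter.eventually_gt_atTop 0] with t ht
    have h₂ : |x| * t ≤ ‖((x : ℂ) * (Complex.I * t) + y)‖ := by
      have := Complex.abs_im_le_norm ((x : ℂ) * (Complex.I * t) + y)
      simpa [abs_mul, abs_of_pos ht] using this
    have h₃ : 0 < |x| * t := mul_pos (abs_pos.mpr hx) ht
    rw [norm_div, norm_one, norm_pow]
    gcongr

/-- The limit of `℘_{L_τ}(x τ + y)` for `τ → i ∞`, where `0 ≤ x < 1`. -/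
noncomputable def cuspValue (x y : ℝ) : ℝ :=
  ∑' n : ℤ, ((if x = 0 then 1 / (y - n) ^ 2 else 0) - 1 / (n : ℝ) ^ 2)

/-- Dominated convergence along the imaginary axis, with A = 0 and B = 1 in the majorant: a term
tends to 0 unless its coefficient of τ vanishes. -/
theorem tendsto_divisionValue {N : ℕ} {a : ℚ × ℚ} (ha : a ∈ frickeIndex N) :
    Filter.Tendsto (fun t => divisionValue a (imagPoint t)) Filter.atTop
      (nhds (cuspValue a.1 a.2 : ℂ)) := by
  obtain ⟨hx, hy, hxy⟩ := frickeIndex_bounds ha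
  obtain ⟨C, hC⟩ := exists_norm_latticeTerm_le le_rfl one_pos hx hy hxy
  set x : ℝ := (a.1 : ℝ)
  set y : ℝ := (a.2 : ℝ)
  let L : ℤ × ℤ → ℂ := fun l => (if x - l.1 = 0 then 1 / ((y - l.2 : ℝ) : ℂ) ^ 2 else 0) -
    (if (l.1 : ℝ) = 0 then 1 / ((l.2 : ℝ) : ℂ) ^ 2 else 0)
  have h₁ : Filter.Tendsto (fun t : ℝ => ∑' l, latticeTerm x y l (Complex.I * t)) Filter.atTop
      (nhds (∑' l, L l)) := by
    refine tendsto_tsum_of_dominated_convergence (summable_latticeMajorant.mul_left C)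
      (fun l => ?_) ?_
    · have := (tendsto_inv_sq_mul_add (x := x - l.1) (y - l.2)).sub
        (tendsto_inv_sq_mul_add (x := l.1) l.2)
      refine this.congr fun t => ?_
      rw [latticeTerm]
      push_cast
      rfl
    · filter_upwards [Filter.eventually_ge_atTop 1] with t ht l
      exact hC l _ (by simp) (by simpa using ht)
  have h₂ : ∑' l, L l = (cuspValue x y : ℂ) := by
    -- Since 0 ≤ x < 1, the limit terms vanish off the row l.1 = 0, which reduces the double sum to
    -- the sum over l.2.
    have hinj : Function.Injective fun n : ℤ => ((0 : ℤ), n) := fun m n h => (Prod.ext_iff.mp h).2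
    rw [cuspValue, Complex.ofReal_tsum, ← hinj.tsum_eq]
    · refine tsum_congr fun n => ?_
      simp only [L, Int.cast_zero, sub_zero, if_true]
      split_ifs <;> push_cast <;> rfl
    · intro l hl
      refine ⟨l.2, Prod.ext ?_ rfl⟩
      by_contra hne
      have hne' : l.1 ≠ 0 := fun h => hne h.symm
      refine hl ?_
      have h₃ : x - l.1 ≠ 0 := by
        rcases lt_or_gt_of_ne hne' with h | h
        · have : (l.1 : ℝ) ≤ -1 := by exact_mod_cast Int.le_sub_one_of_lt h
          linarith
        · have : (1 : ℝ) ≤ l.1 := by exact_mod_cast h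
          linarith
      simp [L, h₃, hne']
  rw [h₂] at h₁
  refine h₁.congr' ?_
  filter_upwards [Filter.eventually_gt_atTop 0] with t ht
  rw [divisionValue_eq_tsum, coe_imagPoint ht]

theorem summable_inv_sub_sq (y : ℝ) : Summable fun n : ℤ => 1 / (y - n) ^ 2 := by
  have h := (Real.summable_one_div_int_add_rpow (-y) 2).mpr one_lt_two
  refine h.congr fun n => ?_
  rw [Real.rpow_two, sq_abs]
  congr 1
  ring

theorem inv_sq_convex_combo_lt {s u v : ℝ} (hs : 0 < s) (hs1 : s < 1) (huv : u ≠ v)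
    (h : 0 < u ∧ 0 < v ∨ u < 0 ∧ v < 0) :
    1 / (s * u + (1 - s) * v) ^ 2 < s * (1 / u ^ 2) + (1 - s) * (1 / v ^ 2) := by
  have key : ∀ u v : ℝ, u ≠ v → 0 < u → 0 < v →
      1 / (s * u + (1 - s) * v) ^ 2 < s * (1 / u ^ 2) + (1 - s) * (1 / v ^ 2) := by
    intro u v huv hu hv
    have := (strictConvexOn_zpow (m := -2) (by norm_num) (by norm_num)).2 hu hv huv hs
      (sub_pos.mpr hs1) (by ring)
    simpa [zpow_neg, zpow_ofNat] using this
  rcases h with h | h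
  · exact key u v huv h.1 h.2
  · have := key (-u) (-v) (fun e => huv (neg_inj.mp e)) (neg_pos.mpr h.1) (neg_pos.mpr h.2)
    rw [show s * -u + (1 - s) * -v = -(s * u + (1 - s) * v) by ring] at this
    simpa only [neg_sq] using this

theorem tsum_inv_one_sub_sub_sq (y : ℝ) :
    ∑' n : ℤ, 1 / (1 - y - n) ^ 2 = ∑' n : ℤ, 1 / (y - n) ^ 2 := by
  rw [← (Equiv.subLeft (1 : ℤ)).tsum_eq]
  refine tsum_congr fun n => ?_
  rw [Equiv.subLeft_apply]
  push_cast
  congr 1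
  ring

/-- The point w is a proper convex combination of y and 1 - y, and no integer lies between these
two, so strict convexity of 1/u² applies to each term. The sums at y and 1 - y agree, hence the
weighted sum is again the sum at y. -/
theorem tsum_inv_sub_sq_lt {y w : ℝ} (hy0 : 0 < y) (hyw : y < w) (hwy : w < 1 - y) :
    ∑' n : ℤ, 1 / (w - n) ^ 2 < ∑' n : ℤ, 1 / (y - n) ^ 2 := by
  have hd : 0 < 1 - 2 * y := by linarith
  set s := (1 - y - w) / (1 - 2 * y) with hs
  have hs0 : 0 < s := div_pos (by linarith) hd
  have hs1 : s < 1 := (div_lt_one hd).mpr (by linarith)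
  have hterm : ∀ n : ℤ, 1 / (w - n) ^ 2 <
      s * (1 / (y - n) ^ 2) + (1 - s) * (1 / (1 - y - n) ^ 2) := by
    intro n
    have hw : w - n = s * (y - n) + (1 - s) * (1 - y - n) := by
      have hsd : s * (1 - 2 * y) = 1 - y - w := div_mul_cancel₀ _ hd.ne'
      linear_combination hsd
    rw [hw]
    refine inv_sq_convex_combo_lt hs0 hs1 (fun e => by linarith) ?_
    rcases le_or_gt n 0 with h | h
    · have : (n : ℝ) ≤ 0 := by exact_mod_cast h
      exact Or.inl ⟨by linarith, by linarith⟩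
    · have : (1 : ℝ) ≤ n := by exact_mod_cast h
      exact Or.inr ⟨by linarith, by linarith⟩
  have hsum₁ := (summable_inv_sub_sq y).mul_left s
  have hsum₂ := (summable_inv_sub_sq (1 - y)).mul_left (1 - s)
  calc _ < ∑' n : ℤ, (s * (1 / (y - n) ^ 2) + (1 - s) * (1 / (1 - y - n) ^ 2)) :=
        Summable.tsum_lt_tsum (fun n => (hterm n).le) (hterm 0) (summable_inv_sub_sq w)
          (hsum₁.add hsum₂)
    _ = _ := by
        rw [hsum₁.tsum_add hsum₂, tsum_mul_left, tsum_mul_left, tsum_inv_one_sub_sub_sq]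
        ring

/-- The reflection y ↦ 1 - y reduces to (0, 1/2], where the sum is strictly decreasing. -/
theorem tsum_inv_sub_sq_inj {y w : ℝ} (hy : 0 < y ∧ y < 1) (hw : 0 < w ∧ w < 1)
    (h : ∑' n : ℤ, 1 / (y - n) ^ 2 = ∑' n : ℤ, 1 / (w - n) ^ 2) : w = y ∨ w = 1 - y := by
  have key : ∀ y w : ℝ, 0 < y → 0 < w → y ≤ 1 / 2 → w ≤ 1 / 2 →
      ∑' n : ℤ, 1 / (y - n) ^ 2 = ∑' n : ℤ, 1 / (w - n) ^ 2 → y = w := by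
    intro y w hy hw hy2 hw2 h
    rcases lt_trichotomy y w with h₁ | h₁ | h₁
    · exact absurd h (tsum_inv_sub_sq_lt hy h₁ (by linarith)).ne'
    · exact h₁
    · exact absurd h (tsum_inv_sub_sq_lt hw h₁ (by linarith)).ne
  rcases le_or_gt y (1 / 2) with hy2 | hy2 <;> rcases le_or_gt w (1 / 2) with hw2 | hw2
  · exact Or.inl (key y w hy.1 hw.1 hy2 hw2 h).symm
  · right
    have := key y (1 - w) hy.1 (by linarith) hy2 (by linarith) (h.trans (tsum_inv_one_sub_sub_sq w).symm)
    linarith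
  · right
    have := key (1 - y) w (by linarith) hw.1 (by linarith) hw2 ((tsum_inv_one_sub_sub_sq y).trans h)
    linarith
  · left
    have := key (1 - y) (1 - w) (by linarith) (by linarith) (by linarith) (by linarith)
      (((tsum_inv_one_sub_sub_sq y).trans h).trans (tsum_inv_one_sub_sub_sq w).symm)
    linarith

/-- For x ≠ 0 the limit is only -∑ 1/n², which is strictly smaller than any limit with x = 0. -/
theorem cuspValue_zero_inj {y x w : ℝ} (hy : 0 < y ∧ y < 1)
    (hw : x = 0 → 0 < w ∧ w < 1) (h : cuspValue 0 y = cuspValue x w) :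
    x = 0 ∧ (w = y ∨ w = 1 - y) := by
  have hS : Summable fun n : ℤ => 1 / (n : ℝ) ^ 2 := Real.summable_one_div_int_pow.mpr one_lt_two
  have h₀ : ∀ y, cuspValue 0 y = ∑' n : ℤ, 1 / (y - n) ^ 2 - ∑' n : ℤ, 1 / (n : ℝ) ^ 2 := by
    intro y
    simp only [cuspValue, if_true]
    exact (summable_inv_sub_sq y).tsum_sub hS
  by_cases hx : x = 0
  · subst hx
    rw [h₀, h₀, sub_left_inj] at h
    exact ⟨rfl, tsum_inv_sub_sq_inj hy (hw rfl) h⟩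
  · exfalso
    rw [h₀] at h
    simp only [cuspValue, if_neg hx, zero_sub, tsum_neg] at h
    have hpos : 0 < ∑' n : ℤ, 1 / (y - n) ^ 2 := by
      refine (summable_inv_sub_sq y).tsum_pos (fun n => by positivity) 0 ?_
      have := hy.1
      simp only [Int.cast_zero, sub_zero]
      positivity
    linarith

/-- Since E₄ and E₆ tend to 1, the common factor E₄E₆/Δ is nonzero high up on the imaginary axis and
can be cancelled; the limits of the division values then agree. -/
theorem eq_of_fricke_eq {N : ℕ} {a b : ℚ × ℚ} (ha : a ∈ frickeIndex N) (hb : b ∈ frickeIndex N)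
    (ha1 : a.1 = 0) (h : fricke a = fricke b) : b.1 = 0 ∧ (b.2 = a.2 ∨ b.2 = 1 - a.2) := by
  have h₁ : (cuspValue a.1 a.2 : ℂ) = (cuspValue b.1 b.2 : ℂ) := by
    refine tendsto_nhds_unique (tendsto_divisionValue ha) ((tendsto_divisionValue hb).congr' ?_)
    have h₄ := tendsto_imagPoint.eventually ((tendsto_E_atImInfty (k := 4) (by norm_num)
      ⟨2, rfl⟩).eventually_ne one_ne_zero)
    have h₆ := tendsto_imagPoint.eventually ((tendsto_E_atImInfty (k := 6) (by norm_num)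
      ⟨3, rfl⟩).eventually_ne one_ne_zero)
    filter_upwards [h₄, h₆] with t h₄ h₆
    have h₂ := congrFun h (imagPoint t)
    rw [fricke_eq, fricke_eq] at h₂
    refine (mul_left_cancel₀ ?_ h₂).symm
    exact mul_ne_zero frickeConst_ne_zero
      (div_ne_zero (mul_ne_zero h₄ h₆) (ModularForm.discriminant_ne_zero _))
  obtain ⟨-, hay, haxy⟩ := frickeIndex_bounds ha
  obtain ⟨-, hby, hbxy⟩ := frickeIndex_bounds hb
  have h₂ : cuspValue a.1 a.2 = cuspValue b.1 b.2 := by exact_mod_cast h₁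
  rw [ha1, Rat.cast_zero] at h₂
  have hay' : (a.2 : ℝ) ≠ 0 := haxy.resolve_left (by simp [ha1])
  obtain ⟨h₃, h₄⟩ := cuspValue_zero_inj ⟨lt_of_le_of_ne hay.1 hay'.symm, hay.2⟩
    (fun hx => ⟨lt_of_le_of_ne hby.1 (hbxy.resolve_left (not_not.mpr hx)).symm, hby.2⟩) h₂
  exact ⟨by exact_mod_cast h₃, h₄.imp (fun h => by exact_mod_cast h) (fun h => by exact_mod_cast h)⟩

/-! ### The stabilizer of the Fricke functions -/

/-- The pair `(v₁ / N, v₂ / N)`. -/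
def divPair (N : ℕ) (v : ℤ × ℤ) : ℚ × ℚ := ((v.1 : ℚ) / N, (v.2 : ℚ) / N)

/-- Reduction of a pair of integers modulo `N`. -/
def modPair (N : ℕ) (v : ℤ × ℤ) : ZMod N × ZMod N := ((v.1 : ZMod N), (v.2 : ZMod N))

theorem divPair_rowMul (N : ℕ) (v : ℤ × ℤ) (γ : SL(2, ℤ)) :
    divPair N (rowMul v γ) = rowMul (divPair N v) γ := by
  ext <;> simp [divPair, rowMul] <;> ring

theorem modPair_rowMul (N : ℕ) (v : ℤ × ℤ) (γ : SL(2, ℤ)) :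
    modPair N (rowMul v γ) = rowMul (modPair N v) γ := by
  ext <;> simp [modPair, rowMul]

theorem rowMul_injective {R : Type*} [CommRing R] (γ : SL(2, ℤ)) :
    Function.Injective fun v : R × R => rowMul v γ := fun v w h => by
  simpa [← rowMul_mul, rowMul_one] using congrArg (rowMul · γ⁻¹) h

theorem fricke_divPair_congr {N : ℕ} (hN : 0 < N) {v w : ℤ × ℤ} (h : modPair N v = modPair N w) :
    fricke (divPair N v) = fricke (divPair N w) := by
  have hN' : (N : ℚ) ≠ 0 := by exact_mod_cast hN.ne'
  have h₁ := (ZMod.intCast_eq_intCast_iff_dvd_sub _ _ _).mp (Prod.ext_iff.mp h).1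
  have h₂ := (ZMod.intCast_eq_intCast_iff_dvd_sub _ _ _).mp (Prod.ext_iff.mp h).2
  obtain ⟨m, hm⟩ := h₁
  obtain ⟨n, hn⟩ := h₂
  rw [← fricke_add_int (divPair N v) m n]
  congr 1
  have e₁ : (w.1 : ℚ) = v.1 + N * m := by
    exact_mod_cast sub_eq_iff_eq_add'.mp hm
  have e₂ : (w.2 : ℚ) = v.2 + N * n := by
    exact_mod_cast sub_eq_iff_eq_add'.mp hn
  ext
  · simp only [divPair, e₁]
    field_simp
  · simp only [divPair, e₂]
    field_simp

theorem modPair_eq_zero_iff (N : ℕ) (v : ℤ × ℤ) :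
    modPair N v = 0 ↔ (N : ℤ) ∣ v.1 ∧ (N : ℤ) ∣ v.2 := by
  rw [modPair, Prod.mk_eq_zero, ZMod.intCast_zmod_eq_zero_iff_dvd,
    ZMod.intCast_zmod_eq_zero_iff_dvd]

theorem exists_nat_rep {N : ℕ} (hN : 0 < N) (v : ℤ × ℤ) (hv : modPair N v ≠ 0) :
    ∃ r s : ℕ, r < N ∧ s < N ∧ (r, s) ≠ (0, 0) ∧ modPair N (r, s) = modPair N v := by
  have : NeZero N := ⟨hN.ne'⟩
  have h : modPair N (((v.1 : ZMod N).val : ℤ), ((v.2 : ZMod N).val : ℤ)) = modPair N v := by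
    simp [modPair]
  refine ⟨(v.1 : ZMod N).val, (v.2 : ZMod N).val, ZMod.val_lt _, ZMod.val_lt _, fun he => hv ?_, h⟩
  rw [← h]
  simp only [Prod.mk.injEq] at he
  simp [modPair, he.1, he.2]

theorem divPair_mem_frickeIndex {N r s : ℕ} (hr : r < N) (hs : s < N) (h : (r, s) ≠ (0, 0)) :
    divPair N (r, s) ∈ frickeIndex N :=
  ⟨r, s, hr, hs, h, by simp [divPair]⟩

/-- Divided by its gcd, v becomes the bottom row of a matrix g in `SL(2, ℤ)`, so g⁻¹ carries v to
(0, gcd). -/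
theorem exists_rowMul_fst_eq_zero (v : ℤ × ℤ) : ∃ γ : SL(2, ℤ), (rowMul v γ).1 = 0 := by
  rcases eq_or_ne v 0 with rfl | hv
  · exact ⟨1, by simp [rowMul]⟩
  have hg : (Int.gcd v.1 v.2 : ℤ) ≠ 0 := by
    rw [Ne, Int.natCast_eq_zero, Int.gcd_eq_zero_iff]
    exact fun h => hv (Prod.ext h.1 h.2)
  obtain ⟨g, h₀, h₁⟩ := (Int.isCoprime_iff_gcd_eq_one.mpr (Int.gcd_ediv_gcd_ediv_gcd
    (Nat.pos_of_ne_zero (by exact_mod_cast hg))) : IsCoprime (v.1 / Int.gcd v.1 v.2) (v.2 / Int.gcd v.1 v.2)).exists_SL2_row 1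
  refine ⟨g⁻¹, ?_⟩
  have h₂ : v = rowMul (0, (Int.gcd v.1 v.2 : ℤ)) g := by
    refine Prod.ext ?_ ?_
    · simp only [rowMul, h₀, h₁, zero_mul, zero_add, Int.cast_id]
      exact (Int.mul_ediv_cancel' (Int.gcd_dvd_left ..)).symm
    · simp only [rowMul, h₀, h₁, zero_mul, zero_add, Int.cast_id]
      exact (Int.mul_ediv_cancel' (Int.gcd_dvd_right ..)).symm
  nth_rw 1 [h₂]
  rw [← rowMul_mul, mul_inv_cancel, rowMul_one]

/-- Equivariance moves v to a vector with first coordinate 0, where the limits at i∞ separate the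
Fricke functions up to sign. -/
theorem modPair_eq_or_eq_neg {N : ℕ} (hN : 0 < N) {v w : ℤ × ℤ} (hv : modPair N v ≠ 0)
    (hw : modPair N w ≠ 0) (h : fricke (divPair N v) = fricke (divPair N w)) :
    modPair N w = modPair N v ∨ modPair N w = -modPair N v := by
  have hN' : (N : ℚ) ≠ 0 := by exact_mod_cast hN.ne'
  obtain ⟨γ, hγ⟩ := exists_rowMul_fst_eq_zero v
  have hne : ∀ u : ℤ × ℤ, modPair N u ≠ 0 → modPair N (rowMul u γ) ≠ 0 := fun u hu h0 => by
    rw [modPair_rowMul] at h0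
    exact hu (rowMul_injective γ (h0.trans (by simp [rowMul, Prod.ext_iff])))
  obtain ⟨r, s, hr, hs, hrs, e⟩ := exists_nat_rep hN _ (hne v hv)
  obtain ⟨r', s', hr', hs', hrs', e'⟩ := exists_nat_rep hN _ (hne w hw)
  have hr0 : r = 0 := by
    have : (r : ZMod N) = 0 := by simpa [modPair, hγ] using congrArg Prod.fst e
    exact Nat.eq_zero_of_dvd_of_lt ((ZMod.natCast_eq_zero_iff r N).mp this) hr
  have hF : fricke (divPair N (r, s)) = fricke (divPair N (r', s')) := by
    rw [fricke_divPair_congr hN e, fricke_divPair_congr hN e', divPair_rowMul, divPair_rowMul]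
    ext τ
    rw [← fricke_smul, ← fricke_smul, h]
  obtain ⟨h₁, h₂⟩ := eq_of_fricke_eq (divPair_mem_frickeIndex hr hs hrs)
    (divPair_mem_frickeIndex hr' hs' hrs') (by simp [divPair, hr0]) hF
  have hr0' : r' = 0 := by simpa [divPair, hN'] using h₁
  have h₃ : s' = s ∨ s' = N - s := by
    refine h₂.imp (fun h => ?_) (fun h => ?_)
    · simp only [divPair, Int.cast_natCast] at h
      field_simp at h
      exact_mod_cast h
    · simp only [divPair, Int.cast_natCast] at h
      field_simp at h
      rw [eq_tsub_iff_add_eq_of_le hs.le]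
      have h' : (s' : ℚ) + s = N := by rw [h]; ring
      exact_mod_cast h'
  have h₄ : modPair N (rowMul w γ) = modPair N (rowMul v γ) ∨
      modPair N (rowMul w γ) = -modPair N (rowMul v γ) := by
    rw [← e, ← e', hr0, hr0']
    refine h₃.imp (fun h => by rw [h]) (fun h => ?_)
    rw [h]
    simp [modPair, Nat.cast_sub hs.le]
  rw [modPair_rowMul, modPair_rowMul, ← rowMul_neg_left] at h₄
  exact h₄.imp (fun h => rowMul_injective γ h) (fun h => rowMul_injective γ h)

theorem modPair_rowMul_of_mem_Gamma {N : ℕ} {γ : SL(2, ℤ)} (h : γ ∈ CongruenceSubgroup.Gamma N)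
    (v : ℤ × ℤ) : modPair N (rowMul v γ) = modPair N v := by
  obtain ⟨h₀, h₁, h₂, h₃⟩ := CongruenceSubgroup.Gamma_mem.mp h
  rw [modPair_rowMul]
  simp [rowMul, h₀, h₁, h₂, h₃]

theorem fricke_smul_of_mem_Gamma {N : ℕ} {γ : SL(2, ℤ)} (h : γ ∈ CongruenceSubgroup.Gamma N)
    {a : ℚ × ℚ} (ha : a ∈ frickeIndex N) (τ : ℍ) : fricke a (γ • τ) = fricke a τ := by
  obtain ⟨r, s, hr, hs, -, rfl⟩ := ha
  have hN : 0 < N := (Nat.zero_le r).trans_lt hr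
  have e : ((r : ℚ) / N, (s : ℚ) / N) = divPair N (r, s) := by simp [divPair]
  rw [e, fricke_smul, ← divPair_rowMul,
    fricke_divPair_congr hN (modPair_rowMul_of_mem_Gamma h _)]

/-- Modulo N, γ sends each of (1, 0), (0, 1) and (1, 1) to plus or minus itself; the third vector
forces the signs of the first two to agree. -/
theorem fricke_smul_eq_iff {N : ℕ} (hN : 0 < N) (γ : SL(2, ℤ)) :
    (∀ a ∈ frickeIndex N, ∀ τ : ℍ, fricke a (γ • τ) = fricke a τ) ↔
      (γ ∈ CongruenceSubgroup.Gamma N ∨ -γ ∈ CongruenceSubgroup.Gamma N) := by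
  constructor
  · intro h
    rcases Nat.lt_or_ge N 2 with hN1 | hN2
    · obtain rfl : N = 1 := by lia
      exact Or.inl (CongruenceSubgroup.mem_Gamma_one γ)
    have : Fact (1 < N) := ⟨hN2⟩
    have key : ∀ r s : ℕ, r < N → s < N → (r, s) ≠ (0, 0) →
        rowMul (modPair N (r, s)) γ = modPair N (r, s) ∨
          rowMul (modPair N (r, s)) γ = -modPair N (r, s) := by
      intro r s hr hs hrs
      have h0 : modPair N (r, s) ≠ 0 := fun h0 => by
        rw [modPair_eq_zero_iff] at h0
        simp only [Int.natCast_dvd_natCast] at h0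
        exact hrs (Prod.ext (Nat.eq_zero_of_dvd_of_lt h0.1 hr) (Nat.eq_zero_of_dvd_of_lt h0.2 hs))
      have h1 : modPair N (rowMul (r, s) γ) ≠ 0 := fun h1 => by
        rw [modPair_rowMul] at h1
        exact h0 (rowMul_injective γ (h1.trans (by simp [rowMul, Prod.ext_iff])))
      rw [← modPair_rowMul]
      refine modPair_eq_or_eq_neg hN h0 h1 (funext fun τ => ?_)
      rw [divPair_rowMul, ← fricke_smul, h _ (divPair_mem_frickeIndex hr hs hrs)]
    have h₁ := key 1 0 (by lia) (by lia) (by simp)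
    have h₂ := key 0 1 (by lia) (by lia) (by simp)
    have h₃ := key 1 1 (by lia) (by lia) (by simp)
    simp only [modPair, rowMul, Prod.mk.injEq, Prod.neg_mk, Nat.cast_one, Nat.cast_zero,
      Int.cast_one, Int.cast_zero, one_mul, zero_mul, add_zero, zero_add, neg_zero] at h₁ h₂ h₃
    rw [CongruenceSubgroup.Gamma_mem, CongruenceSubgroup.Gamma_mem]
    simp only [Matrix.SpecialLinearGroup.coe_neg, Matrix.neg_apply, Int.cast_neg,
      neg_eq_iff_eq_neg, neg_zero]
    rcases h₁ with h₁ | h₁ <;> rcases h₂ with h₂ | h₂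
    · exact Or.inl ⟨h₁.1, h₁.2, h₂.1, h₂.2⟩
    · rw [h₁.1, h₁.2, h₂.1, h₂.2] at h₃
      -- Opposite signs on the basis vectors yield 1 = -1 in `ZMod N`, and then the two signs
      -- coincide.
      rcases h₃ with h₃ | h₃
      · exact Or.inl ⟨h₁.1, h₁.2, h₂.1, h₂.2.trans (by simpa using h₃.2)⟩
      · exact Or.inr ⟨h₁.1.trans (by simpa using h₃.1), h₁.2, h₂.1, h₂.2⟩
    · rw [h₁.1, h₁.2, h₂.1, h₂.2] at h₃
      rcases h₃ with h₃ | h₃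
      · exact Or.inl ⟨h₁.1.trans (by simpa using h₃.1), h₁.2, h₂.1, h₂.2⟩
      · exact Or.inr ⟨h₁.1, h₁.2, h₂.1, h₂.2.trans (by simpa using h₃.2)⟩
    · exact Or.inr ⟨h₁.1, h₁.2, h₂.1, h₂.2⟩
  · rintro (h | h) a ha τ
    · exact fricke_smul_of_mem_Gamma h ha τ
    · rw [← fricke_smul_of_mem_Gamma h ha τ, ModularGroup.SL_neg_smul]


/-! ### Composition of meromorphic functions with `SL(2, ℤ)` -/

theorem analyticAt_coe_smul (γ : SL(2, ℤ)) (τ : ℍ) :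
    AnalyticAt ℂ (fun z => ((γ • ofComplex z : ℍ) : ℂ)) τ := by
  have h : (fun z : ℂ => ((γ 0 0 : ℤ) * z + (γ 0 1 : ℤ)) / ((γ 1 0 : ℤ) * z + (γ 1 1 : ℤ)))
      =ᶠ[nhds (τ : ℂ)] fun z => ((γ • ofComplex z : ℍ) : ℂ) := by
    filter_upwards [isOpen_upperHalfPlaneSet.mem_nhds τ.im_pos] with z hz
    rw [coe_smul_eq_div, automorphyFactor, ofComplex_apply_of_im_pos hz]
  refine AnalyticAt.congr ?_ h
  exact ((analyticAt_const.mul analyticAt_id).add analyticAt_const).div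
    ((analyticAt_const.mul analyticAt_id).add analyticAt_const) (automorphyFactor_ne_zero γ τ)

/-- The chain rule applied to γ⁻¹ ∘ γ = id. A nonzero derivative is what makes orders of zeros and
poles invariant under γ. -/
theorem deriv_coe_smul_ne_zero (γ : SL(2, ℤ)) (τ : ℍ) :
    deriv (fun z => ((γ • ofComplex z : ℍ) : ℂ)) τ ≠ 0 := by
  intro h
  have h₁ : (fun z => ((γ⁻¹ • ofComplex z : ℍ) : ℂ)) ∘ (fun z => ((γ • ofComplex z : ℍ) : ℂ))
      =ᶠ[nhds (τ : ℂ)] id := by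
    filter_upwards [isOpen_upperHalfPlaneSet.mem_nhds τ.im_pos] with z hz
    simp only [Function.comp_apply, ofComplex_apply, inv_smul_smul, id_eq]
    rw [ofComplex_apply_of_im_pos hz]
  have h₂ := h₁.deriv_eq
  have e : ((γ • ofComplex (τ : ℂ) : ℍ) : ℂ) = ((γ • τ : ℍ) : ℂ) := by rw [ofComplex_apply]
  rw [deriv_comp, h, mul_zero, deriv_id] at h₂
  · exact zero_ne_one h₂
  · rw [e]
    exact (analyticAt_coe_smul γ⁻¹ (γ • τ)).differentiableAt
  · exact (analyticAt_coe_smul γ τ).differentiableAt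

theorem comp_smul_comp_ofComplex (f : ℍ → ℂ) (γ : SL(2, ℤ)) :
    (fun τ : ℍ => f (γ • τ)) ∘ ofComplex =
      (f ∘ ofComplex) ∘ fun z => ((γ • ofComplex z : ℍ) : ℂ) := by
  ext z
  simp

theorem IsMeromorphic.comp_smul {f : ℍ → ℂ} (hf : IsMeromorphic f) (γ : SL(2, ℤ)) :
    IsMeromorphic fun τ => f (γ • τ) := by
  intro τ
  rw [comp_smul_comp_ofComplex]
  refine MeromorphicAt.comp_analyticAt ?_ (analyticAt_coe_smul γ τ)
  simpa using hf (γ • τ)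

theorem meromorphicOrderAt_comp_smul (f : ℍ → ℂ) (γ : SL(2, ℤ)) (τ : ℍ) :
    meromorphicOrderAt ((fun τ : ℍ => f (γ • τ)) ∘ ofComplex) τ =
      meromorphicOrderAt (f ∘ ofComplex) ((γ • τ : ℍ) : ℂ) := by
  rw [comp_smul_comp_ofComplex, meromorphicOrderAt_comp_of_deriv_ne_zero
    (analyticAt_coe_smul γ τ) (deriv_coe_smul_ne_zero γ τ)]
  simp

theorem continuous_coe_smul (γ : SL(2, ℤ)) : Continuous fun τ : ℍ => γ • τ := by
  rw [continuous_iff_continuousAt]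
  intro τ
  rw [isOpenEmbedding_coe.isInducing.continuousAt_iff]
  have h₁ := (analyticAt_coe_smul γ τ).continuousAt
  have h₂ : ContinuousAt ((fun z => ((γ • ofComplex z : ℍ) : ℂ)) ∘ ((↑) : ℍ → ℂ)) τ :=
    ContinuousAt.comp h₁ continuous_coe.continuousAt
  refine h₂.congr (Filter.Eventually.of_forall fun w => ?_)
  simp

theorem eventually_codiscrete_smul {p : ℍ → Prop} (h : ∀ᶠ τ in Filter.codiscrete ℍ, p τ)
    (γ : SL(2, ℤ)) : ∀ᶠ τ in Filter.codiscrete ℍ, p (γ • τ) := by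
  rw [eventually_codiscrete_iff] at h ⊢
  intro τ
  have h₁ : Filter.Tendsto (fun w : ℍ => γ • w) (nhdsWithin τ {τ}ᶜ)
      (nhdsWithin (γ • τ) {γ • τ}ᶜ) :=
    (continuous_coe_smul γ).continuousAt.continuousWithinAt.tendsto_nhdsWithin
      fun w hw h => hw (smul_left_cancel γ h)
  exact h₁.eventually (h (γ • τ))

theorem nhdsNE_neBot (τ : ℍ) : (nhdsWithin τ ({τ}ᶜ : Set ℍ)).NeBot := by
  rw [← Filter.frequently_true_iff_neBot]
  intro h
  obtain ⟨_, h₁⟩ := (eventually_nhdsNE_coe_iff (τ := τ) (p := fun _ => ¬True)).mpr h |>.exists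
  exact h₁ trivial

/-- ℍ has no isolated points. This turns equality in the field of meromorphic functions into
equality at every point. -/
theorem eq_of_eventually_codiscrete {f g : ℍ → ℂ} (hf : Continuous f) (hg : Continuous g)
    (h : ∀ᶠ τ in Filter.codiscrete ℍ, f τ = g τ) : f = g := by
  ext τ
  rw [eventually_codiscrete_iff] at h
  have := nhdsNE_neBot τ
  exact tendsto_nhds_unique (hf.continuousAt.tendsto.mono_left nhdsWithin_le_nhds)
    ((hg.continuousAt.tendsto.mono_left nhdsWithin_le_nhds).congr' ((h τ).mono fun _ h => h.symm))

theorem continuous_of_analyticAt {f : ℍ → ℂ} (hf : ∀ τ : ℍ, AnalyticAt ℂ (f ∘ ofComplex) τ) :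
    Continuous f := by
  rw [continuous_iff_continuousAt]
  intro τ
  have h : ContinuousAt ((f ∘ ofComplex) ∘ ((↑) : ℍ → ℂ)) τ :=
    ContinuousAt.comp (hf τ).continuousAt continuous_coe.continuousAt
  refine h.congr (Filter.Eventually.of_forall fun w => ?_)
  simp

theorem mdifferentiable_of_analyticAt {f : ℍ → ℂ}
    (hf : ∀ τ : ℍ, AnalyticAt ℂ (f ∘ ofComplex) τ) :
    MDifferentiable (modelWithCornersSelf ℂ ℂ) (modelWithCornersSelf ℂ ℂ) f :=
  UpperHalfPlane.mdifferentiable_iff.mpr fun z hz =>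
    (hf ⟨z, hz⟩).differentiableAt.differentiableWithinAt

theorem periodic_comp_ofComplex_of_vadd {f : ℍ → ℂ} {h : ℝ} (hf : ∀ τ : ℍ, f (h +ᵥ τ) = f τ) :
    Function.Periodic (f ∘ ofComplex) h := by
  intro w
  by_cases! hw : 0 < w.im
  · have h₁ : 0 < (w + h).im := by simp [hw]
    simp only [Function.comp_apply, ofComplex_apply_of_im_pos h₁, ofComplex_apply_of_im_pos hw]
    rw [← hf ⟨w, hw⟩]
    congr 1
    ext
    simp [add_comm]
  · have : (w + h).im ≤ 0 := by simpa using hw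
    simp [ofComplex_apply_of_im_nonpos this, ofComplex_apply_of_im_nonpos hw]

/-! ### Meromorphy of j and the Fricke functions at the cusps -/

/-- A holomorphic function of period `N` on `ℍ` that is of at most exponential growth at `i ∞`
is a meromorphic function of `exp (2 π i τ / N)`. -/
theorem exists_meromorphicAt_qParam {N : ℕ} (hN : 0 < N) {f : ℍ → ℂ}
    (hf : ∀ τ : ℍ, AnalyticAt ℂ (f ∘ ofComplex) τ) (hper : ∀ τ : ℍ, f ((N : ℝ) +ᵥ τ) = f τ)
    {C c Y : ℝ} (hgr : ∀ τ : ℍ, |τ.re| ≤ N → Y ≤ τ.im → ‖f τ‖ ≤ C * Real.exp (c * τ.im)) :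
    ∃ F : ℂ → ℂ, MeromorphicAt F 0 ∧
      ∀ τ : ℍ, f τ = F (Function.Periodic.qParam (N : ℝ) (τ : ℂ)) := by
  have hN' : (0 : ℝ) < N := by exact_mod_cast hN
  -- Since |q| = exp(-2π Im τ / N), this n makes f qⁿ bounded; its cusp function is then holomorphic
  -- at 0, and dividing by zⁿ recovers f.
  obtain ⟨n, hn⟩ := exists_nat_ge (c * N / (2 * Real.pi))
  have hn' : c ≤ 2 * Real.pi * n / N := by
    rw [div_le_iff₀ (by positivity)] at hn
    rw [le_div_iff₀ hN']
    linarith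
  let q : ℍ → ℂ := fun τ => Function.Periodic.qParam (N : ℝ) (τ : ℂ)
  let g : ℍ → ℂ := fun τ => f τ * q τ ^ n
  have hqper : ∀ τ : ℍ, q ((N : ℝ) +ᵥ τ) = q τ := fun τ => by
    have h0 : (N : ℂ) ≠ 0 := by exact_mod_cast hN.ne'
    simp only [q, coe_vadd, Function.Periodic.qParam]
    rw [← Complex.exp_periodic (2 * Real.pi * Complex.I * τ / (N : ℝ))]
    congr 1
    push_cast
    field_simp
    ring
  have hgper : ∀ τ : ℍ, g ((N : ℝ) +ᵥ τ) = g τ := fun τ => by simp only [g, hper, hqper]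
  have hgan : ∀ τ : ℍ, AnalyticAt ℂ (g ∘ ofComplex) τ := by
    intro τ
    have h₁ : AnalyticAt ℂ (fun z => (f ∘ ofComplex) z *
        Function.Periodic.qParam (N : ℝ) z ^ n) τ := by
      refine (hf τ).mul (AnalyticAt.pow ?_ n)
      exact Function.Periodic.differentiable_qParam.analyticAt _
    refine h₁.congr ?_
    filter_upwards [isOpen_upperHalfPlaneSet.mem_nhds τ.im_pos] with z hz
    simp only [g, q, Function.comp_apply, ofComplex_apply_of_im_pos hz]
  have hbd : ∀ τ : ℍ, |τ.re| ≤ N → Y ≤ τ.im → ‖g τ‖ ≤ C := by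
    intro τ h₁ h₂
    have h₃ := hgr τ h₁ h₂
    have hC : 0 ≤ C := by
      by_contra! h
      have := h₃.trans_lt (mul_neg_of_neg_of_pos h (Real.exp_pos _))
      exact absurd this (norm_nonneg _).not_gt
    have h₄ : ‖q τ‖ ^ n = Real.exp (-(2 * Real.pi * n / N) * τ.im) := by
      simp only [q, Function.Periodic.norm_qParam, coe_im]
      rw [← Real.exp_nat_mul]
      congr 1
      ring
    rw [norm_mul, norm_pow, h₄]
    calc _ ≤ C * Real.exp (c * τ.im) * Real.exp (-(2 * Real.pi * n / N) * τ.im) := by gcongr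
      _ = C * Real.exp ((c - 2 * Real.pi * n / N) * τ.im) := by
          rw [mul_assoc, ← Real.exp_add]
          congr 2
          ring
      _ ≤ C * 1 := by
          gcongr
          rw [Real.exp_le_one_iff]
          exact mul_nonpos_of_nonpos_of_nonneg (by linarith) τ.im_pos.le
      _ = C := mul_one C
  have hgb : IsBoundedAtImInfty g := by
    rw [isBoundedAtImInfty_iff]
    refine ⟨C, Y, fun τ hτ => ?_⟩
    -- The growth hypothesis covers only a strip; translation by a multiple of N moves every point
    -- to 0 ≤ Re τ ≤ N.
    have hshift : ∀ (m : ℤ) (τ : ℍ), g (((m * N : ℝ)) +ᵥ τ) = g τ := by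
      intro m
      have h₁ := (periodic_comp_ofComplex_of_vadd hgper).int_mul m
      intro τ
      have h₂ := h₁ τ
      simp only [Function.comp_apply, ofComplex_apply] at h₂
      rw [← h₂]
      congr 1
      ext
      rw [ofComplex_apply_of_im_pos (by simpa using τ.im_pos)]
      simp [add_comm]
    have h₂ := hbd (((-⌊τ.re / N⌋ : ℤ) * N : ℝ) +ᵥ τ) ?_ (by simpa using hτ)
    · rwa [hshift] at h₂
    · rw [vadd_re, Int.cast_neg, neg_mul, neg_add_eq_sub, abs_le]
      have h₃ := Int.floor_le (τ.re / N)
      have h₄ := (Int.lt_floor_add_one (τ.re / N)).le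
      rw [le_div_iff₀ hN'] at h₃
      rw [div_le_iff₀ hN'] at h₄
      constructor <;> linarith
  have hF := UpperHalfPlane.analyticAt_cuspFunction_zero hN'
    (periodic_comp_ofComplex_of_vadd hgper) (mdifferentiable_of_analyticAt hgan) hgb
  refine ⟨fun z => cuspFunction N g z / z ^ n,
    hF.meromorphicAt.div (analyticAt_id.pow n).meromorphicAt, fun τ => ?_⟩
  simp only
  rw [eq_cuspFunction τ hN'.ne' (periodic_comp_ofComplex_of_vadd hgper)]
  exact (mul_div_cancel_right₀ _ (pow_ne_zero n (Function.Periodic.qParam_ne_zero _))).symm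

theorem exists_norm_inv_discriminant_le :
    ∃ C Y : ℝ, 0 ≤ C ∧ ∀ τ : ℍ, Y ≤ τ.im →
      ‖(ModularForm.discriminant τ)⁻¹‖ ≤ C * Real.exp (2 * Real.pi * τ.im) := by
  obtain ⟨C, hC⟩ := ModularForm.exp_isBigO_discriminant.bound
  obtain ⟨Y, -, hY⟩ := atImInfty_basis.eventually_iff.mp hC
  refine ⟨max C 0, Y, le_max_right _ _, fun τ hτ => ?_⟩
  have h₁ := hY hτ
  have hΔ : 0 < ‖ModularForm.discriminant τ‖ :=
    norm_pos_iff.mpr (ModularForm.discriminant_ne_zero τ)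
  rw [Real.norm_of_nonneg (Real.exp_pos _).le] at h₁
  rw [norm_inv, inv_le_iff_one_le_mul₀ hΔ]
  have h₂ : Real.exp (-2 * Real.pi * τ.im) * Real.exp (2 * Real.pi * τ.im) = 1 := by
    rw [← Real.exp_add, Real.exp_eq_one_iff]
    ring
  calc 1 = Real.exp (-2 * Real.pi * τ.im) * Real.exp (2 * Real.pi * τ.im) := h₂.symm
    _ ≤ C * ‖ModularForm.discriminant τ‖ * Real.exp (2 * Real.pi * τ.im) := by gcongr
    _ ≤ max C 0 * ‖ModularForm.discriminant τ‖ * Real.exp (2 * Real.pi * τ.im) := by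
        gcongr
        exact le_max_left _ _
    _ = _ := by ring

theorem exists_norm_E_le {k : ℕ} (hk : 3 ≤ k) (hk2 : Even k) :
    ∃ Y : ℝ, ∀ τ : ℍ, Y ≤ τ.im → ‖ModularForm.E hk τ‖ ≤ 2 := by
  have h := (tendsto_E_atImInfty hk hk2).norm.eventually_le_const
    (by norm_num : ‖(1 : ℂ)‖ < 2)
  obtain ⟨Y, -, hY⟩ := atImInfty_basis.eventually_iff.mp h
  exact ⟨Y, fun τ hτ => hY hτ⟩

theorem exists_norm_jFunction_le : ∃ C Y : ℝ, ∀ τ : ℍ, Y ≤ τ.im →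
    ‖jFunction τ‖ ≤ C * Real.exp (2 * Real.pi * τ.im) := by
  obtain ⟨C, Y, hC, h⟩ := exists_norm_inv_discriminant_le
  obtain ⟨Y', h'⟩ := exists_norm_E_le (k := 4) (by norm_num) ⟨2, rfl⟩
  refine ⟨2 ^ 3 * C, max Y Y', fun τ hτ => ?_⟩
  rw [jFunction_eq, div_eq_mul_inv, norm_mul, norm_pow, mul_assoc]
  have h₁ := h τ ((le_max_left _ _).trans hτ)
  have h₂ := h' τ ((le_max_right _ _).trans hτ)
  gcongr

theorem exists_norm_fricke_le {N : ℕ} {a : ℚ × ℚ} (ha : a ∈ frickeIndex N) :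
    ∃ C Y : ℝ, ∀ τ : ℍ, |τ.re| ≤ N → Y ≤ τ.im →
      ‖fricke a τ‖ ≤ C * Real.exp (2 * Real.pi * τ.im) := by
  obtain ⟨C, Y, hC, h⟩ := exists_norm_inv_discriminant_le
  obtain ⟨Y₄, h₄⟩ := exists_norm_E_le (k := 4) (by norm_num) ⟨2, rfl⟩
  obtain ⟨Y₆, h₆⟩ := exists_norm_E_le (k := 6) (by norm_num) ⟨3, rfl⟩
  obtain ⟨D, hD⟩ := exists_norm_divisionValue_le ha (A := N) (by positivity) one_pos
  refine ⟨‖frickeConst‖ * (2 * 2 * C) * D, max (max Y 1) (max Y₄ Y₆), fun τ hr hτ => ?_⟩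
  obtain ⟨⟨hY, h1⟩, hY4, hY6⟩ := (max_le_iff.mp hτ).imp max_le_iff.mp max_le_iff.mp
  have e₁ := h τ hY
  have e₂ := h₄ τ hY4
  have e₃ := h₆ τ hY6
  have e₄ := hD τ hr h1
  rw [fricke_eq, div_eq_mul_inv, norm_mul, norm_mul, norm_mul, norm_mul]
  calc _ ≤ ‖frickeConst‖ * (2 * 2 * (C * Real.exp (2 * Real.pi * τ.im))) * D := by gcongr
    _ = _ := by ring

theorem vadd_eq_T_pow_smul (N : ℕ) (τ : ℍ) : (N : ℝ) +ᵥ τ = (ModularGroup.T ^ N : SL(2, ℤ)) • τ := by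
  have h := modular_T_zpow_smul τ N
  rw [zpow_natCast] at h
  rw [h]
  simp

theorem T_pow_mem_Gamma (N : ℕ) : (ModularGroup.T ^ N : SL(2, ℤ)) ∈ CongruenceSubgroup.Gamma N := by
  have h := ModularGroup.coe_T_zpow N
  rw [zpow_natCast] at h
  rw [CongruenceSubgroup.Gamma_mem, h]
  simp

theorem isMeromorphic_jFunction : IsMeromorphic jFunction :=
  fun τ => (analyticAt_jFunction τ).meromorphicAt

theorem isMeromorphic_fricke {N : ℕ} {a : ℚ × ℚ} (ha : a ∈ frickeIndex N) :
    IsMeromorphic (fricke a) :=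
  fun τ => (analyticAt_fricke ha τ).meromorphicAt

theorem isModularFunction_jFunction {N : ℕ} (hN : 0 < N) : IsModularFunction N jFunction where
  meromorphic := isMeromorphic_jFunction
  invariant γ _ := Filter.Eventually.of_forall fun τ => jFunction_smul γ τ
  cusps γ := by
    obtain ⟨C, Y, h⟩ := exists_norm_jFunction_le
    obtain ⟨F, hF, h'⟩ := exists_meromorphicAt_qParam hN analyticAt_jFunction
      (fun τ => by rw [vadd_eq_T_pow_smul, jFunction_smul]) (fun τ _ hτ => h τ hτ)
    exact ⟨F, hF, 0, Filter.Eventually.of_forall fun τ _ => by rw [jFunction_smul, h']⟩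

/-- The Fricke functions of level N are permuted by `SL(2, ℤ)`, so their behaviour at every cusp
reduces to i∞. -/
theorem exists_fricke_smul_eq {N : ℕ} {a : ℚ × ℚ} (ha : a ∈ frickeIndex N) (γ : SL(2, ℤ)) :
    ∃ b ∈ frickeIndex N, ∀ τ : ℍ, fricke a (γ • τ) = fricke b τ := by
  obtain ⟨r, s, hr, hs, hrs, rfl⟩ := ha
  have hN : 0 < N := (Nat.zero_le r).trans_lt hr
  have e : ((r : ℚ) / N, (s : ℚ) / N) = divPair N (r, s) := by simp [divPair]
  have h0 : modPair N (r, s) ≠ 0 := fun h0 => by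
    rw [modPair_eq_zero_iff] at h0
    simp only [Int.natCast_dvd_natCast] at h0
    exact hrs (Prod.ext (Nat.eq_zero_of_dvd_of_lt h0.1 hr) (Nat.eq_zero_of_dvd_of_lt h0.2 hs))
  have h1 : modPair N (rowMul (r, s) γ) ≠ 0 := fun h1 => by
    rw [modPair_rowMul] at h1
    exact h0 (rowMul_injective γ (h1.trans (by simp [rowMul, Prod.ext_iff])))
  obtain ⟨r', s', hr', hs', hrs', e'⟩ := exists_nat_rep hN _ h1
  refine ⟨_, divPair_mem_frickeIndex hr' hs' hrs', fun τ => ?_⟩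
  rw [e, fricke_smul, ← divPair_rowMul, fricke_divPair_congr hN e']

theorem isModularFunction_fricke {N : ℕ} {a : ℚ × ℚ} (ha : a ∈ frickeIndex N) :
    IsModularFunction N (fricke a) where
  meromorphic := isMeromorphic_fricke ha
  invariant γ hγ := Filter.Eventually.of_forall fun τ => fricke_smul_of_mem_Gamma hγ ha τ
  cusps γ := by
    have hN : 0 < N := by
      obtain ⟨r, s, hr, -⟩ := ha
      exact (Nat.zero_le r).trans_lt hr
    obtain ⟨b, hb, hab⟩ := exists_fricke_smul_eq ha γ
    obtain ⟨C, Y, h⟩ := exists_norm_fricke_le hb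
    obtain ⟨F, hF, h'⟩ := exists_meromorphicAt_qParam hN (analyticAt_fricke hb)
      (fun τ => by rw [vadd_eq_T_pow_smul, fricke_smul_of_mem_Gamma (T_pow_mem_Gamma N) hb]) h
    exact ⟨F, hF, 0, Filter.Eventually.of_forall fun τ _ => by rw [hab, h']⟩


/-! ### Invariant modular functions are rational in j -/

/-- A level one modular form of weight `12 k` is `Δ ^ k` times a polynomial in `j`. -/
theorem exists_polynomial_jFunction (k : ℕ) : ∀ (w : ℤ) (_ : w = 12 * k) (g : ModularForm 𝒮ℒ w),
    ∃ p : Polynomial ℂ, ∀ τ, g τ = ModularForm.discriminant τ ^ k * p.eval (jFunction τ) := by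
  induction k with
  | zero =>
    rintro w rfl g
    obtain ⟨c, hc⟩ := ModularFormClass.levelOne_weight_zero_const (F := ModularForm 𝒮ℒ 0) g
    exact ⟨Polynomial.C c, fun τ => by simpa using congrFun hc τ⟩
  | succ k ih =>
    intro w hw g
    -- Subtracting the right multiple of E₄^{3(k+1)} leaves a cusp form, which is Δ times a form of
    -- weight 12k. Since E₄³ = jΔ, the subtracted part contributes the monomial in j of degree k +
    -- 1.
    let G : ModularForm 𝒮ℒ w :=
      ModularForm.mcast (by rw [hw]; push_cast; ring) (ModularForm.E₄.pow (3 * (k + 1)))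
    have hG : ∀ τ, G τ = ModularForm.E₄ τ ^ (3 * (k + 1)) := fun τ => by
      simp only [G, ModularForm.coe_mcast, ModularForm.coe_pow, Pi.pow_apply]
    have hG0 : (qExpansion 1 G).coeff 0 = 1 := by
      simp only [G, ModularForm.coe_mcast,
        ModularForm.qExpansion_pow one_pos one_mem_strictPeriods_SL]
      have := EisensteinSeries.E_qExpansion_coeff_zero (k := 4) (by norm_num) ⟨2, rfl⟩
      rw [PowerSeries.coeff_zero_eq_constantCoeff] at this ⊢
      rw [map_pow, this, one_pow]
    obtain ⟨u, hu⟩ := ModularForm.sub_smul_isCuspForm g G hG0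
    set c := (qExpansion 1 g).coeff 0
    obtain ⟨p, hp⟩ := ih (w - 12) (by rw [hw]; push_cast; ring) (CuspForm.discriminantEquiv u)
    refine ⟨p + Polynomial.C c * Polynomial.X ^ (k + 1), fun τ => ?_⟩
    have h₁ : u τ = g τ - c * G τ := congrFun (congrArg DFunLike.coe hu) τ
    have h₂ := ModularForm.discriminant_mul_discriminantEquiv_apply u τ
    have hΔ := ModularForm.discriminant_ne_zero τ
    rw [hp τ, h₁, hG] at h₂
    have h₃ : g τ = ModularForm.discriminant τ * (ModularForm.discriminant τ ^ k *
        p.eval (jFunction τ)) + c * ModularForm.E₄ τ ^ (3 * (k + 1)) := by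
      rw [h₂]; ring
    rw [h₃]
    have hj : ModularForm.E₄ τ ^ 3 = jFunction τ * ModularForm.discriminant τ := by
      rw [jFunction_eq, div_mul_cancel₀ _ hΔ]
    simp only [Polynomial.eval_add, Polynomial.eval_mul, Polynomial.eval_C, Polynomial.eval_pow,
      Polynomial.eval_X, pow_mul, hj]
    ring

theorem analyticAt_comp_qParam {N : ℕ} {G : ℂ → ℂ} {z : ℂ}
    (hG : AnalyticAt ℂ G (Function.Periodic.qParam (N : ℝ) z)) (n : ℕ) :
    AnalyticAt ℂ (fun z => G (Function.Periodic.qParam (N : ℝ) z) /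
      Function.Periodic.qParam (N : ℝ) z ^ n) z := by
  have hq : AnalyticAt ℂ (Function.Periodic.qParam (N : ℝ)) z :=
    Function.Periodic.differentiable_qParam.analyticAt _
  exact (AnalyticAt.fun_comp hG hq).div (hq.pow n) (pow_ne_zero n (Function.Periodic.qParam_ne_zero _))

/-- Near `i ∞` a modular function has no poles, and grows at most exponentially. -/
theorem IsModularFunction.exists_bound {N : ℕ} (hN : 0 < N) {f : ℍ → ℂ}
    (hf : IsModularFunction N f) : ∃ Y C c : ℝ,
      (∀ τ : ℍ, Y < τ.im → 0 ≤ meromorphicOrderAt (f ∘ ofComplex) τ) ∧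
      ∀ᶠ τ in Filter.codiscrete ℍ, Y < τ.im → ‖f τ‖ ≤ C * Real.exp (c * τ.im) := by
  have hN' : (0 : ℝ) < N := by exact_mod_cast hN
  obtain ⟨F, ⟨n, hG⟩, Y₀, hfF⟩ := hf.cusps 1
  simp only [one_smul, sub_zero] at hfF hG
  -- G clears the pole of F at 0, so near i∞ the function f is G(q) / qⁿ with G analytic and
  -- bounded, and q never vanishes.
  set G : ℂ → ℂ := fun z => z ^ n • F z
  have hev : ∀ᶠ z in nhds (0 : ℂ), AnalyticAt ℂ G z ∧ ‖G z‖ ≤ ‖G 0‖ + 1 :=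
    hG.eventually_analyticAt.and
      (hG.continuousAt.norm.eventually_le_const (lt_add_one _))
  obtain ⟨Y₁, -, hY₁⟩ := atImInfty_basis.eventually_iff.mp
    ((qParam_tendsto_atImInfty hN').eventually hev)
  have heq : ∀ᶠ τ : ℍ in Filter.codiscrete ℍ, max Y₀ Y₁ < τ.im →
      f τ = G (Function.Periodic.qParam (N : ℝ) (τ : ℂ)) /
        Function.Periodic.qParam (N : ℝ) (τ : ℂ) ^ n := by
    filter_upwards [hfF] with τ h hτ
    rw [h ((le_max_left _ _).trans_lt hτ)]
    simp only [G, smul_eq_mul]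
    rw [mul_div_cancel_left₀ _ (pow_ne_zero n (Function.Periodic.qParam_ne_zero _))]
  refine ⟨max Y₀ Y₁, ‖G 0‖ + 1, 2 * Real.pi * n / N, fun τ hτ => ?_, ?_⟩
  · have h₁ := (eventually_codiscrete_iff.mp heq) τ
    have h₂ : ∀ᶠ w : ℍ in nhdsWithin τ {τ}ᶜ, max Y₀ Y₁ < w.im :=
      mem_nhdsWithin_of_mem_nhds (continuous_im.continuousAt.eventually_const_lt hτ)
    have h₃ : f ∘ ofComplex =ᶠ[nhdsWithin (τ : ℂ) {(τ : ℂ)}ᶜ]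
        fun z => G (Function.Periodic.qParam (N : ℝ) z) /
          Function.Periodic.qParam (N : ℝ) z ^ n := by
      refine eventually_nhdsNE_coe_iff.mpr ?_
      filter_upwards [h₁, h₂] with w h₁ h₂
      simpa using h₁ h₂
    rw [meromorphicOrderAt_congr h₃]
    exact (analyticAt_comp_qParam
      (hY₁ ((le_max_right _ _).trans hτ.le)).1 n).meromorphicOrderAt_nonneg
  · filter_upwards [heq] with τ h hτ
    have h₁ := (hY₁ ((le_max_right _ _).trans hτ.le)).2
    rw [h hτ, norm_div, norm_pow, Function.Periodic.norm_qParam, coe_im, div_eq_mul_inv,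
      ← Real.exp_nat_mul, ← Real.exp_neg,
      show -((n : ℝ) * (-2 * Real.pi * τ.im / N)) = 2 * Real.pi * n / N * τ.im by ring]
    gcongr

/-- Poles are isolated, so each point has a neighbourhood with no pole except possibly itself;
compactness leaves finitely many. -/
theorem finite_poles_inter_compact {f : ℍ → ℂ} (hf : IsMeromorphic f) {K : Set ℍ}
    (hK : IsCompact K) : {τ | τ ∈ K ∧ ¬0 ≤ meromorphicOrderAt (f ∘ ofComplex) τ}.Finite := by
  have h : ∀ τ : ℍ, ∀ᶠ w : ℍ in nhds τ, w ≠ τ → 0 ≤ meromorphicOrderAt (f ∘ ofComplex) w := by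
    intro τ
    have h₁ := eventually_nhdsNE_coe_iff.mp (hf τ).eventually_analyticAt
    filter_upwards [eventually_nhdsWithin_iff.mp h₁] with w hw hne
    exact (hw hne).meromorphicOrderAt_nonneg
  obtain ⟨t, -, ht⟩ := hK.elim_nhds_subcover _ fun τ _ => h τ
  refine t.finite_toSet.subset fun τ hτ => ?_
  obtain ⟨w, hw, hτw⟩ := Set.mem_iUnion₂.mp (ht hτ.1)
  by_cases he : τ = w
  · exact he ▸ hw
  · exact absurd (hτw he) hτ.2

theorem toField_eq_iff {f g : ℍ → ℂ} (hf : IsMeromorphic f) (hg : IsMeromorphic g) :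
    toField f hf = toField g hg ↔ ∀ᶠ τ in Filter.codiscrete ℍ, f τ = g τ := by
  rw [toField, toField, Ideal.Quotient.mk_eq_mk_iff_sub_mem]
  change (∀ᶠ τ in Filter.codiscrete ℍ, f τ - g τ = 0) ↔ _
  simp only [sub_eq_zero]

theorem toField_mul {f g : ℍ → ℂ} (hf : IsMeromorphic f) (hg : IsMeromorphic g)
    (hfg : IsMeromorphic (f * g)) : toField (f * g) hfg = toField f hf * toField g hg := rfl

theorem isMeromorphic_polynomial_jFunction (p : Polynomial ℂ) :
    IsMeromorphic fun τ => p.eval (jFunction τ) := fun τ =>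
  (AnalyticAt.aeval_polynomial (analyticAt_jFunction τ) p).meromorphicAt

theorem toField_polynomial_jFunction (p : Polynomial ℂ) :
    toField (fun τ => p.eval (jFunction τ)) (isMeromorphic_polynomial_jFunction p) =
      Polynomial.aeval (toField jFunction isMeromorphic_jFunction) p := by
  have h₁ : Polynomial.aeval (toField jFunction isMeromorphic_jFunction) p =
      Ideal.Quotient.mkₐ ℂ nullIdeal (Polynomial.aeval
        (⟨jFunction, isMeromorphic_jFunction⟩ : meromorphicSubalgebra) p) :=
    Polynomial.aeval_algHom_apply (Ideal.Quotient.mkₐ ℂ nullIdeal)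
      (⟨jFunction, isMeromorphic_jFunction⟩ : meromorphicSubalgebra) p
  rw [h₁, toField, Ideal.Quotient.mkₐ_eq_mk]
  congr 1
  apply Subtype.ext
  rw [Polynomial.aeval_subalgebra_coe]
  ext τ
  simp

/-- Otherwise E₄³ = cΔ, whose sides tend to 1 and 0 at i∞. -/
theorem jFunction_ne_const (c : ℂ) : jFunction ≠ fun _ => c := by
  intro h
  have h₁ : Filter.Tendsto (fun τ => ModularForm.E₄ τ ^ 3) atImInfty (nhds (1 ^ 3)) :=
    (tendsto_E_atImInfty (k := 4) (by norm_num) ⟨2, rfl⟩).pow 3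
  have h₂ : Filter.Tendsto (fun τ => c * ModularForm.discriminant τ) atImInfty
      (nhds (c * 0)) :=
    Filter.Tendsto.const_mul c ModularForm.discriminant_isZeroAtImInfty
  have h₃ : (fun τ => ModularForm.E₄ τ ^ 3) = fun τ => c * ModularForm.discriminant τ := by
    ext τ
    have := congrFun h τ
    rw [jFunction_eq, div_eq_iff (ModularForm.discriminant_ne_zero τ)] at this
    exact this
  rw [h₃] at h₁
  have := tendsto_nhds_unique h₁ h₂
  norm_num at this

theorem toField_jFunction_ne_algebraMap (c : ℂ) :
    toField jFunction isMeromorphic_jFunction ≠ algebraMap ℂ MeromorphicField c := by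
  intro h
  have h₁ : toField jFunction isMeromorphic_jFunction =
      toField (fun _ => c) (isModularFunction_const 1 c).meromorphic := h
  rw [toField_eq_iff] at h₁
  exact jFunction_ne_const c (eq_of_eventually_codiscrete
    (continuous_of_analyticAt analyticAt_jFunction) continuous_const h₁)

theorem isModularFunction_polynomial_jFunction {N : ℕ} (hN : 0 < N) (p : Polynomial ℂ) :
    IsModularFunction N fun τ => p.eval (jFunction τ) := by
  induction p using Polynomial.induction_on' with
  | add p q hp hq => simp only [Polynomial.eval_add]; exact hp.add hq
  | monomial n c =>
    simp only [Polynomial.eval_monomial]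
    refine (isModularFunction_const N c).mul ?_
    induction n with
    | zero => simpa using isModularFunction_const N 1
    | succ n ih => simp only [pow_succ]; exact ih.mul (isModularFunction_jFunction hN)

theorem nonneg_add_toNat_mul {o d : WithTop ℤ} (hd : 1 ≤ d) :
    0 ≤ o + ((-(o.untopD 0)).toNat : WithTop ℤ) * d := by
  cases o with
  | top => simp
  | coe m =>
    simp only [WithTop.untopD_coe]
    rcases le_or_gt 0 m with hm | hm
    · rw [Int.toNat_of_nonpos (by lia)]
      simpa using hm
    · cases d with
      | top =>
        have h₁ : (((-m).toNat : ℕ) : WithTop ℤ) ≠ 0 := by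
          rw [Ne, Nat.cast_eq_zero]
          lia
        rw [WithTop.mul_top h₁]
        simp
      | coe e =>
        have he : 1 ≤ e := by exact_mod_cast hd
        have h₂ : (0 : ℤ) ≤ m + ((-m).toNat : ℤ) * e := by
          rw [Int.toNat_of_nonneg (by lia)]
          nlinarith
        exact_mod_cast h₂

/-- The poles of a modular function that is invariant under `SL(2, ℤ)` are removed by a
polynomial in `j`. -/
theorem exists_polynomial_mul_order_nonneg {N : ℕ} (hN : 0 < N) {f : ℍ → ℂ}
    (hf : IsModularFunction N f)
    (hinv : ∀ γ : SL(2, ℤ), ∀ᶠ τ in Filter.codiscrete ℍ, f (γ • τ) = f τ) :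
    ∃ P : Polynomial ℂ, Polynomial.aeval (toField jFunction isMeromorphic_jFunction) P ≠ 0 ∧
      ∀ τ : ℍ, 0 ≤ meromorphicOrderAt
        ((f * fun τ => P.eval (jFunction τ)) ∘ ofComplex) τ := by
  obtain ⟨Y, -, -, hY, -⟩ := hf.exists_bound hN
  have hfin := finite_poles_inter_compact hf.meromorphic
    (ModularGroup.isCompact_truncatedFundamentalDomain Y)
  -- n is the pole order. The default at order ⊤ is harmless, since such a point is not a pole. Each
  -- factor j - j(σ) vanishes at σ, so its n-th power cancels the pole there.
  let n : ℍ → ℕ := fun τ => (-((meromorphicOrderAt (f ∘ ofComplex) τ).untopD 0)).toNat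
  let q : ℍ → Polynomial ℂ := fun σ => (Polynomial.X - Polynomial.C (jFunction σ)) ^ n σ
  let P : Polynomial ℂ := ∏ σ ∈ hfin.toFinset, q σ
  have hP : ∀ (p : Polynomial ℂ) (τ : ℍ),
      AnalyticAt ℂ ((fun τ => p.eval (jFunction τ)) ∘ ofComplex) τ :=
    fun p τ => AnalyticAt.aeval_polynomial (analyticAt_jFunction τ) p
  refine ⟨P, ?_, ?_⟩
  · simp only [P, q, map_prod, map_pow, map_sub, Polynomial.aeval_X, Polynomial.aeval_C]
    exact Finset.prod_ne_zero_iff.mpr fun σ _ =>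
      pow_ne_zero _ (sub_ne_zero.mpr (toField_jFunction_ne_algebraMap _))
  have hfd : ∀ τ ∈ ModularGroup.fd, 0 ≤ meromorphicOrderAt
        ((f * fun τ => P.eval (jFunction τ)) ∘ ofComplex) τ := by
    intro τ hτ
    change 0 ≤ meromorphicOrderAt
      ((f ∘ ofComplex) * ((fun τ => P.eval (jFunction τ)) ∘ ofComplex)) τ
    by_cases ho : 0 ≤ meromorphicOrderAt (f ∘ ofComplex) τ
    · rw [meromorphicOrderAt_mul (hf.meromorphic τ) (hP P τ).meromorphicAt]
      exact add_nonneg ho (hP P τ).meromorphicOrderAt_nonneg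
    · have hmem : τ ∈ hfin.toFinset := by
        rw [Set.Finite.mem_toFinset]
        exact ⟨⟨hτ, not_lt.mp fun h => ho (hY τ h)⟩, ho⟩
      classical
      set Q : Polynomial ℂ := ∏ σ ∈ hfin.toFinset.erase τ, q σ
      have hPQ : P = q τ * Q := (Finset.mul_prod_erase _ _ hmem).symm
      have e : ((fun τ => P.eval (jFunction τ)) ∘ ofComplex) =
          (fun z : ℂ => (jFunction ∘ ofComplex) z - jFunction τ) ^ n τ *
            ((fun τ => Q.eval (jFunction τ)) ∘ ofComplex) := by
        ext z
        simp [hPQ, q]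
      have hj : AnalyticAt ℂ (fun z : ℂ => (jFunction ∘ ofComplex) z - jFunction τ) τ :=
        (analyticAt_jFunction τ).sub analyticAt_const
      have hj1 : 1 ≤ meromorphicOrderAt (fun z : ℂ => (jFunction ∘ ofComplex) z - jFunction τ) τ := by
        have h0 : 0 < meromorphicOrderAt (fun z : ℂ => (jFunction ∘ ofComplex) z - jFunction τ) τ := by
          rw [← tendsto_zero_iff_meromorphicOrderAt_pos hj.meromorphicAt]
          have h₁ := hj.continuousAt.tendsto.mono_left
            (nhdsWithin_le_nhds (s := {(τ : ℂ)}ᶜ))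
          simpa using h₁
        revert h0
        cases meromorphicOrderAt (fun z : ℂ => (jFunction ∘ ofComplex) z - jFunction τ) τ with
        | top => simp
        | coe m =>
          intro h0
          have : 0 < m := by exact_mod_cast h0
          exact_mod_cast Int.add_one_le_iff.mpr this
      rw [e, meromorphicOrderAt_mul (hf.meromorphic τ)
        ((hj.pow _).meromorphicAt.mul (hP Q τ).meromorphicAt),
        meromorphicOrderAt_mul (hj.pow _).meromorphicAt (hP Q τ).meromorphicAt,
        meromorphicOrderAt_pow hj.meromorphicAt, ← add_assoc]
      exact add_nonneg (nonneg_add_toNat_mul hj1) (hP Q τ).meromorphicOrderAt_nonneg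
  -- Every point is moved into the fundamental domain; orders are preserved because f and j are
  -- invariant.
  intro τ
  obtain ⟨γ, hγ⟩ := ModularGroup.exists_smul_mem_fd τ
  have h₁ := hfd _ hγ
  rw [← meromorphicOrderAt_comp_smul] at h₁
  rwa [meromorphicOrderAt_congr] at h₁
  refine eventually_nhdsNE_coe_iff.mpr ?_
  filter_upwards [eventually_codiscrete_iff.mp (hinv γ) τ] with w hw
  simp only [Function.comp_apply, ofComplex_apply, Pi.mul_apply]
  rw [hw, jFunction_smul]

/-- A meromorphic function without poles agrees with a holomorphic function. -/
theorem exists_analytic_extension {f : ℍ → ℂ} (hf : IsMeromorphic f)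
    (h : ∀ τ : ℍ, 0 ≤ meromorphicOrderAt (f ∘ ofComplex) τ) :
    ∃ g : ℍ → ℂ, (∀ τ : ℍ, AnalyticAt ℂ (g ∘ ofComplex) τ) ∧
      ∀ᶠ τ in Filter.codiscrete ℍ, f τ = g τ := by
  have hU : MeromorphicOn (f ∘ ofComplex) {z : ℂ | 0 < z.im} := fun z hz => hf ⟨z, hz⟩
  -- The normal form redefines the function at its removable singularities and is analytic wherever
  -- the order is nonnegative.
  set F := toMeromorphicNFOn (f ∘ ofComplex) {z : ℂ | 0 < z.im} with hF
  refine ⟨fun τ => F τ, fun τ => ?_, ?_⟩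
  · have h₁ : AnalyticAt ℂ F τ := by
      rw [← (meromorphicNFOn_toMeromorphicNFOn (f ∘ ofComplex) {z : ℂ | 0 < z.im}
        τ.im_pos).meromorphicOrderAt_nonneg_iff_analyticAt,
        meromorphicOrderAt_toMeromorphicNFOn hU τ.im_pos]
      exact h τ
    refine h₁.congr ?_
    filter_upwards [isOpen_upperHalfPlaneSet.mem_nhds τ.im_pos] with z hz
    simp [ofComplex_apply_of_im_pos hz]
  · rw [eventually_codiscrete_iff]
    intro τ
    have h₁ := eventually_nhdsNE_coe_iff.mp (hU.toMeromorphicNFOn_eq_self_on_nhdsNE τ.im_pos)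
    filter_upwards [h₁] with w hw
    rw [hF, hw]
    simp

/-- A holomorphic function on `ℍ` that is invariant under `SL(2, ℤ)` and is of at most exponential
growth at `i ∞` is a polynomial in `j`. -/
theorem exists_polynomial_of_invariant {h : ℍ → ℂ}
    (hh : ∀ τ : ℍ, AnalyticAt ℂ (h ∘ ofComplex) τ) (hinv : ∀ (γ : SL(2, ℤ)) (τ : ℍ), h (γ • τ) = h τ)
    {Y C c : ℝ} (hgr : ∀ τ : ℍ, Y < τ.im → ‖h τ‖ ≤ C * Real.exp (c * τ.im)) :
    ∃ p : Polynomial ℂ, ∀ τ, h τ = p.eval (jFunction τ) := by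
  -- Δ decays like exp(-2π Im τ), so Δ^k h is bounded at i∞ and is a modular form of weight 12k.
  obtain ⟨k, hk⟩ := exists_nat_ge (c / (2 * Real.pi))
  rw [div_le_iff₀ (by positivity)] at hk
  let g : ℍ → ℂ := fun τ => ModularForm.discriminant τ ^ k * h τ
  have hslash : ∀ γ : SL(2, ℤ), g ∣[(12 * k : ℤ)] γ = g := by
    intro γ
    ext τ
    have hne := automorphyFactor_ne_zero γ τ
    rw [ModularForm.SL_slash_apply, ← automorphyFactor_eq_denom]
    simp only [g, hinv, discriminant_smul]
    rw [zpow_neg, show (12 * k : ℤ) = ((12 * k : ℕ) : ℤ) by push_cast; rfl, zpow_natCast]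
    field_simp
    ring
  have hbdd : IsBoundedAtImInfty g := by
    have hΔ : (fun τ => ModularForm.discriminant τ) =O[atImInfty]
        fun τ => Real.exp (-2 * Real.pi * τ.im / 1) :=
      CuspFormClass.exp_decay_atImInfty (h := 1) CuspForm.discriminant one_pos
        one_mem_strictPeriods_SL
    obtain ⟨D, hD⟩ := hΔ.bound
    obtain ⟨Y', -, hY'⟩ := atImInfty_basis.eventually_iff.mp hD
    rw [isBoundedAtImInfty_iff]
    refine ⟨D ^ k * C, max Y' (Y + 1), fun τ hτ => ?_⟩
    have h₁ := hY' ((le_max_left _ _).trans hτ)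
    have h₂ := hgr τ ((lt_add_one Y).trans_le ((le_max_right _ _).trans hτ))
    rw [Real.norm_of_nonneg (Real.exp_pos _).le, div_one] at h₁
    have hD0 : 0 ≤ D := nonneg_of_mul_nonneg_left ((norm_nonneg _).trans h₁) (Real.exp_pos _)
    have hC0 : 0 ≤ C := nonneg_of_mul_nonneg_left ((norm_nonneg _).trans h₂) (Real.exp_pos _)
    rw [norm_mul, norm_pow]
    calc _ ≤ (D * Real.exp (-2 * Real.pi * τ.im)) ^ k * (C * Real.exp (c * τ.im)) := by gcongr
      _ = D ^ k * C * Real.exp ((c - k * (2 * Real.pi)) * τ.im) := by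
          rw [mul_pow, ← Real.exp_nat_mul, mul_mul_mul_comm, ← Real.exp_add]
          congr 2
          ring
      _ ≤ D ^ k * C * 1 := by
          gcongr
          rw [Real.exp_le_one_iff]
          exact mul_nonpos_of_nonpos_of_nonneg (by linarith) τ.im_pos.le
      _ = _ := mul_one _
  let M : ModularForm 𝒮ℒ (12 * k : ℤ) :=
    { toFun := g
      slash_action_eq' := fun _ ⟨γ, hγ⟩ => hγ ▸ hslash γ
      holo' := mdifferentiable_of_analyticAt fun τ => ((analyticAt_discriminant τ).pow k).mul (hh τ)
      bdd_at_cusps' := fun {c} hc => by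
        rw [Subgroup.IsArithmetic.isCusp_iff_isCusp_SL2Z] at hc
        rw [OnePoint.isBoundedAt_iff_forall_SL2Z hc]
        intro γ _
        rw [hslash γ]
        exact hbdd }
  obtain ⟨p, hp⟩ := exists_polynomial_jFunction k _ rfl M
  exact ⟨p, fun τ => mul_left_cancel₀ (pow_ne_zero k (ModularForm.discriminant_ne_zero τ)) (hp τ)⟩

/-- A modular function that is invariant under `SL(2, ℤ)` is a rational function of `j`. -/
theorem toField_mem_adjoin_jFunction {N : ℕ} (hN : 0 < N) {f : ℍ → ℂ}
    (hf : IsModularFunction N f)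
    (hinv : ∀ γ : SL(2, ℤ), ∀ᶠ τ in Filter.codiscrete ℍ, f (γ • τ) = f τ) :
    toField f hf.meromorphic ∈
      IntermediateField.adjoin ℂ {toField jFunction isMeromorphic_jFunction} := by
  obtain ⟨P, hP0, hP⟩ := exists_polynomial_mul_order_nonneg hN hf hinv
  have hg := hf.mul (isModularFunction_polynomial_jFunction hN P)
  obtain ⟨h, hh, hgh⟩ := exists_analytic_extension hg.meromorphic hP
  have hcont := continuous_of_analyticAt hh
  obtain ⟨Y, C, c, -, hgr⟩ := hg.exists_bound hN
  have hhinv : ∀ (γ : SL(2, ℤ)) (τ : ℍ), h (γ • τ) = h τ := by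
    intro γ
    refine congrFun (eq_of_eventually_codiscrete (hcont.comp (continuous_coe_smul γ)) hcont ?_)
    filter_upwards [hgh, eventually_codiscrete_smul hgh γ, hinv γ] with τ h₁ h₂ h₃
    rw [← h₁, ← h₂]
    simp only [Pi.mul_apply, h₃, jFunction_smul]
  -- The bound holds off a discrete set and extends to every point by continuity.
  have hhgr : ∀ τ : ℍ, Y < τ.im → ‖h τ‖ ≤ C * Real.exp (c * τ.im) := by
    intro τ hτ
    have := nhdsNE_neBot τ
    have hc : Continuous fun τ : ℍ => C * Real.exp (c * τ.im) := by
      have := continuous_im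
      fun_prop
    refine le_of_tendsto_of_tendsto
      (hcont.norm.continuousAt.tendsto.mono_left (nhdsWithin_le_nhds (s := {τ}ᶜ)))
      (hc.continuousAt.tendsto.mono_left nhdsWithin_le_nhds) ?_
    have h₂ : ∀ᶠ w : ℍ in nhdsWithin τ {τ}ᶜ, Y < w.im :=
      mem_nhdsWithin_of_mem_nhds (continuous_im.continuousAt.eventually_const_lt hτ)
    filter_upwards [eventually_codiscrete_iff.mp hgh τ, eventually_codiscrete_iff.mp hgr τ, h₂]
      with w h₁ h₂ h₃
    rw [← h₁]
    exact h₂ h₃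
  obtain ⟨p, hp⟩ := exists_polynomial_of_invariant hh hhinv hhgr
  set J := toField jFunction isMeromorphic_jFunction
  have h₁ : toField f hf.meromorphic * Polynomial.aeval J P = Polynomial.aeval J p := by
    rw [← toField_polynomial_jFunction, ← toField_polynomial_jFunction,
      ← toField_mul _ _ hg.meromorphic, toField_eq_iff]
    filter_upwards [hgh] with τ h
    rw [h, hp]
  rw [eq_div_of_mul_eq hP0 h₁]
  have hJ : J ∈ IntermediateField.adjoin ℂ {J} := IntermediateField.mem_adjoin_simple_self ℂ J
  have key : ∀ p : Polynomial ℂ, Polynomial.aeval J p ∈ IntermediateField.adjoin ℂ {J} :=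
    fun p => by
      have := (Polynomial.aeval (⟨J, hJ⟩ : IntermediateField.adjoin ℂ {J}) p).2
      rwa [← IntermediateField.aeval_coe] at this
  exact div_mem (key p) (key P)


/-! ### Galois theory of the field of modular functions -/

theorem IsModularFunction.comp_smul {N : ℕ} {f : ℍ → ℂ} (hf : IsModularFunction N f)
    (γ : SL(2, ℤ)) : IsModularFunction N fun τ => f (γ • τ) where
  meromorphic := hf.meromorphic.comp_smul γ
  invariant δ hδ := by
    -- Normality of `Γ(N)` lets δ pass across γ as γδγ⁻¹.
    have h₁ := (CongruenceSubgroup.Gamma_normal N).conj_mem δ hδ γ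
    filter_upwards [eventually_codiscrete_smul (hf.invariant _ h₁) γ] with τ h
    rw [← h, smul_smul, smul_smul, inv_mul_cancel_right]
  cusps δ := by
    obtain ⟨F, hF, Y, h⟩ := hf.cusps (γ * δ)
    refine ⟨F, hF, Y, ?_⟩
    filter_upwards [h] with τ h hτ
    rw [smul_smul, h hτ]

/-- Composition with `γ ∈ SL(2, ℤ)`, on meromorphic functions. -/
noncomputable def compSMul (γ : SL(2, ℤ)) : meromorphicSubalgebra →ₐ[ℂ] meromorphicSubalgebra where
  toFun f := ⟨fun τ => (f : ℍ → ℂ) (γ • τ), IsMeromorphic.comp_smul f.2 γ⟩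
  map_one' := rfl
  map_mul' _ _ := rfl
  map_zero' := rfl
  map_add' _ _ := rfl
  commutes' _ := rfl

/-- Composition with `γ ∈ SL(2, ℤ)`, on the field of meromorphic functions. -/
noncomputable def fieldCompSMul (γ : SL(2, ℤ)) : MeromorphicField →ₐ[ℂ] MeromorphicField :=
  Ideal.quotientMapₐ nullIdeal (compSMul γ) fun _ hf => eventually_codiscrete_smul hf γ

theorem fieldCompSMul_mem {N : ℕ} (γ : SL(2, ℤ)) {x : MeromorphicField}
    (hx : x ∈ modularFunctionField N) : fieldCompSMul γ x ∈ modularFunctionField N := by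
  obtain ⟨f, hf, rfl⟩ := hx
  exact ⟨_, hf.comp_smul γ, rfl⟩

/-- Composition with `γ ∈ SL(2, ℤ)`, on the field of modular functions of level `N`. -/
noncomputable def modularCompSMul (N : ℕ) (γ : SL(2, ℤ)) :
    modularFunctionField N →ₐ[ℂ] modularFunctionField N :=
  ((fieldCompSMul γ).comp (modularFunctionField N).val).codRestrict
    (modularFunctionField N).toSubalgebra fun x => fieldCompSMul_mem γ x.2

/-- The element of `F_{N,ℂ}` that is given by `f`. -/
noncomputable def toModularField {N : ℕ} {f : ℍ → ℂ} (hf : IsModularFunction N f) :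
    modularFunctionField N := ⟨toField f hf.meromorphic, f, hf, rfl⟩

theorem exists_eq_toModularField {N : ℕ} (x : modularFunctionField N) :
    ∃ (f : ℍ → ℂ) (hf : IsModularFunction N f), x = toModularField hf := by
  obtain ⟨_, f, hf, rfl⟩ := x
  exact ⟨f, hf, rfl⟩

theorem modularCompSMul_toModularField {N : ℕ} (γ : SL(2, ℤ)) {f : ℍ → ℂ}
    (hf : IsModularFunction N f) :
    modularCompSMul N γ (toModularField hf) = toModularField (hf.comp_smul γ) := rfl

theorem toModularField_eq_iff {N : ℕ} {f g : ℍ → ℂ} (hf : IsModularFunction N f)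
    (hg : IsModularFunction N g) :
    toModularField hf = toModularField hg ↔ ∀ᶠ τ in Filter.codiscrete ℍ, f τ = g τ := by
  rw [← toField_eq_iff hf.meromorphic hg.meromorphic, Subtype.ext_iff]
  rfl

/-- The action of `SL(2, ℤ)` on the field of modular functions of level `N`. -/
noncomputable def modularAut (N : ℕ) :
    SL(2, ℤ) →* (modularFunctionField N ≃ₐ[ℂ] modularFunctionField N) :=
  (AlgEquiv.algHomUnitsEquiv ℂ (modularFunctionField N)).toMonoidHom.comp
    (MonoidHom.toHomUnits
      -- Composition with γ reverses products; the inverse restores the order.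
      { toFun := fun γ => modularCompSMul N γ⁻¹
        map_one' := by
          ext x
          obtain ⟨f, hf, rfl⟩ := exists_eq_toModularField x
          rw [modularCompSMul_toModularField, AlgHom.one_apply]
          congr 1
          refine (toModularField_eq_iff _ hf).mpr (Filter.Eventually.of_forall fun τ => ?_)
          rw [inv_one, one_smul]
        map_mul' := fun γ δ => by
          ext x
          obtain ⟨f, hf, rfl⟩ := exists_eq_toModularField x
          rw [AlgHom.mul_apply]
          simp only [modularCompSMul_toModularField]
          congr 1
          refine (toModularField_eq_iff _ _).mpr (Filter.Eventually.of_forall fun τ => ?_)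
          rw [mul_inv_rev, mul_smul] })

theorem modularAut_toModularField {N : ℕ} (γ : SL(2, ℤ)) {f : ℍ → ℂ}
    (hf : IsModularFunction N f) :
    modularAut N γ (toModularField hf) = toModularField (hf.comp_smul γ⁻¹) := rfl

theorem Gamma_le_ker_modularAut (N : ℕ) : CongruenceSubgroup.Gamma N ≤ (modularAut N).ker := by
  intro γ hγ
  rw [MonoidHom.mem_ker]
  ext x
  obtain ⟨f, hf, rfl⟩ := exists_eq_toModularField x
  rw [modularAut_toModularField, AlgEquiv.one_apply]
  congr 1
  exact (toModularField_eq_iff _ _).mpr (hf.invariant _ (inv_mem hγ))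

theorem modularAut_neg (N : ℕ) (γ : SL(2, ℤ)) : modularAut N (-γ) = modularAut N γ := by
  ext x
  obtain ⟨f, hf, rfl⟩ := exists_eq_toModularField x
  rw [modularAut_toModularField, modularAut_toModularField]
  congr 1
  refine (toModularField_eq_iff _ _).mpr (Filter.Eventually.of_forall fun τ => ?_)
  rw [show (-γ)⁻¹ = -γ⁻¹ from inv_eq_of_mul_eq_one_right (by simp), ModularGroup.SL_neg_smul]

/-- The kernel contains `Γ(N)`, which has finite index. Finiteness is what Artin's theorem requires.
-/
instance (N : ℕ) [NeZero N] : Finite (modularAut N).range := by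
  have h : (modularAut N).ker.FiniteIndex :=
    Subgroup.finiteIndex_of_le (Gamma_le_ker_modularAut N)
  have : Finite (SL(2, ℤ) ⧸ (modularAut N).ker) := inferInstance
  exact Finite.of_equiv _ (QuotientGroup.quotientKerEquivRange (modularAut N)).toEquiv

/-- A field `E` of modular functions that contains `j`, and that is fixed elementwise only by those
`γ` that act trivially on all modular functions, is the field of all modular functions. -/
theorem modularFunctionField_le {N : ℕ} (hN : 0 < N) {E : IntermediateField ℂ MeromorphicField}
    (hj : toField jFunction isMeromorphic_jFunction ∈ E)
    (h : ∀ γ : SL(2, ℤ), (∀ x : modularFunctionField N, (x : MeromorphicField) ∈ E →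
      modularAut N γ x = x) → modularAut N γ = 1) :
    modularFunctionField N ≤ E := by
  have : NeZero N := ⟨hN.ne'⟩
  let H := (modularAut N).range
  have := Fintype.ofFinite H
  let K := FixedPoints.subfield H (modularFunctionField N)
  -- An element fixed by all of H is `SL(2, ℤ)`-invariant, hence lies in ℂ(j), which is contained in
  -- E.
  have hK : ∀ x ∈ K, (x : MeromorphicField) ∈ E := by
    intro x hx
    obtain ⟨f, hf, rfl⟩ := exists_eq_toModularField x
    have h₁ := toField_mem_adjoin_jFunction hN hf fun γ => by
      have h₂ : modularAut N γ⁻¹ (toModularField hf) = toModularField hf :=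
        hx ⟨modularAut N γ⁻¹, γ⁻¹, rfl⟩
      rw [modularAut_toModularField, toModularField_eq_iff] at h₂
      simpa using h₂
    exact IntermediateField.adjoin_le_iff.mpr (Set.singleton_subset_iff.mpr hj) h₁
  let L : IntermediateField K (modularFunctionField N) :=
    Subfield.toIntermediateField (E.toSubfield.comap (modularFunctionField N).val.toRingHom)
      fun x => hK x x.2
  -- By Artin's theorem every automorphism over K comes from some γ; if it fixes L = E ∩ F_N it is
  -- trivial by hypothesis.
  have hL : L.fixingSubgroup = ⊥ := by
    rw [eq_bot_iff]
    intro σ hσ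
    obtain ⟨⟨_, γ, rfl⟩, rfl⟩ := FixedPoints.toAlgAut_surjective H (modularFunctionField N) σ
    rw [IntermediateField.mem_fixingSubgroup_iff] at hσ
    have h₁ : (⟨modularAut N γ, γ, rfl⟩ : H) = 1 := Subtype.ext (h γ hσ)
    rw [h₁, map_one]
    exact one_mem _
  have hL' : L = ⊤ := by
    rw [← IsGalois.fixedField_fixingSubgroup L, hL, IntermediateField.fixedField_bot]
  intro x hx
  have : (⟨x, hx⟩ : modularFunctionField N) ∈ L := hL' ▸ IntermediateField.mem_top
  exact this

end ModularFunctions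

theorem mainTheorem11 (N : ℕ) (hN : 0 < N) :
    (∃ (hj : IsMeromorphic jFunction) (hf : ∀ a ∈ frickeIndex N, IsMeromorphic (fricke a)),
      modularFunctionField N =
        IntermediateField.adjoin ℂ
          ({toField jFunction hj} ∪
            {x | ∃ (a : ℚ × ℚ) (ha : a ∈ frickeIndex N), x = toField (fricke a) (hf a ha)})) ∧
    (∀ γ : SL(2, ℤ),
      (∀ a ∈ frickeIndex N, ∀ τ : ℍ, fricke a (γ • τ) = fricke a τ) ↔
        (γ ∈ CongruenceSubgroup.Gamma N ∨ -γ ∈ CongruenceSubgroup.Gamma N)) := by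
  refine ⟨⟨isMeromorphic_jFunction, fun a ha => isMeromorphic_fricke ha, le_antisymm ?_ ?_⟩,
    fricke_smul_eq_iff hN⟩
  · refine modularFunctionField_le hN
      (IntermediateField.subset_adjoin _ _ (Or.inl rfl)) fun γ hγ => ?_
    have h₁ : ∀ a ∈ frickeIndex N, ∀ τ : ℍ, fricke a (γ⁻¹ • τ) = fricke a τ := by
      intro a ha
      have h₂ := hγ (toModularField (isModularFunction_fricke ha))
        (IntermediateField.subset_adjoin _ _ (Or.inr ⟨a, ha, rfl⟩))
      rw [modularAut_toModularField, toModularField_eq_iff] at h₂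
      have hc := continuous_of_analyticAt (analyticAt_fricke ha)
      exact congrFun (eq_of_eventually_codiscrete (hc.comp (continuous_coe_smul γ⁻¹)) hc h₂)
    -- The automorphism attached to γ composes with γ⁻¹, so the stabilizer criterion concerns γ⁻¹.
    rw [← inv_inj, ← map_inv, inv_one]
    rcases (fricke_smul_eq_iff hN γ⁻¹).mp h₁ with h₂ | h₂
    · exact Gamma_le_ker_modularAut N h₂
    · rw [← modularAut_neg]
      exact Gamma_le_ker_modularAut N h₂
  · rw [IntermediateField.adjoin_le_iff]
    rintro _ (rfl | ⟨a, ha, rfl⟩)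
    · exact ⟨_, isModularFunction_jFunction hN, rfl⟩
    · exact ⟨_, isModularFunction_fricke ha, rfl⟩
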